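/- Let $\Omega\subset\mathbb R^n$, $n\ge 2$, be a bounded domain (open connected set) with smooth boundary, and let $\Gamma\Subset\Omega$ be a nonempty domain with smooth boundary such that $\Omega\setminus\overline\Gamma$ is connected. For $j=1,2$ let $g_j\in C^\infty(\overline\Omega;\mathbb R^{n\times n})$ be a Riemannian metric which is uniformly elliptic, i.e. $\lambda|\xi|^2\le (g_j)_{ik}(x)\xi^i\xi^k\le\lambda^{-1}|\xi|^2$ for all $x\in\Omega$, $\xi\in\mathbb R^n$ and some $\lambda\in(0,1)$, and let $0\le V_j\in C^\infty(\overline\Omega)$. Let $dV_{g}=(\det g)^{1/2}dx$ and let $\mathsf P_{g,V}=-\Delta_{g}+V$ be the operator on the real space $L^2(\Omega,dV_{g})$ with domain $\{u\in H^1_0(\Omega): (-\Delta_g+V)u\in L^2(\Omega,dV_g)\text{ weakly}\}$. Denote by $e^{-t\mathsf P_{g,V}}(x,z)$, $t>0$, $x,z\in\Omega$, the heat kernel, i.e. the (almost everywhere uniquely determined) function in $L^\infty(\Omega\times\Omega)$ with $$e^{-t\mathsf P_{g,V}}f(x)=\int_\Omega e^{-t\mathsf P_{g,V}}(x,z)f(z)\,dV_g(z)\quad\text{for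 a.e. }x\in\Omega,\ f\in L^2(\Omega,dV_g),$$ where $u(t)=e^{-t\mathsf P_{g,V}}f$ is the unique solution of $\partial_tu+\mathsf P_{g,V}u=0$ for $t>0$, $u(0)=f$, in $C([0,\infty);L^2)\cap C^1((0,\infty);L^2)\cap C((0,\infty);\mathsf{Dom}(\mathsf P_{g,V}))$. Suppose that $g_1=g_2$ and $V_1=V_2$ on $\Gamma$, and that for every $t>0$ $$e^{-t\mathsf P_{g_1,V_1}}(x,z)=e^{-t\mathsf P_{g_2,V_2}}(x,z)\quad\text{for a.e. }(x,z)\in\Gamma\times\Gamma.$$ Then for every $F\in C_c^\infty(\Gamma\times(0,\infty))$ the local source-to-solution maps of the two wave equations are well defined at $F$ and agree: $$\mathcal J^\Gamma_{g_1,V_1}F=\mathcal J^\Gamma_{g_2,V_2}F,\qquad \mathcal J^\Gamma_{g_j,V_j}F:=w_j|_{\Gamma\times[0,\infty)},$$ where $w_j$ with $w_j\in C([0,\infty);\mathsf{Dom}(\mathsf P_{g_j,V_j}))$, $\partial_tw_j\in C([0,\infty);H^1_0(\Omega))$, $\partial_t^2w_j\in C([0,\infty);L^2(\Omega,dV_{g_j}))$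 solves $$(\partial_t^2+\mathsf P_{g_j,V_j})w_j=F\ \text{ in }\Omega\times(0,\infty),\qquad w_j(0)=\partial_tw_j(0)=0\ \text{ in }\Omega.$$ Here "well defined at $F$" means that such a $w_j$ exists and that its restriction $w_j(t)|_\Gamma\in L^2(\Gamma)$, $t\ge0$, does not depend on the choice of $w_j$. -/

import Mathlib

open MeasureTheory Set
open scoped ContDiff NNReal

noncomputable section

namespace WaveHeat

/-- The coordinate space `ℝⁿ`. -/
abbrev Sp (n : ℕ) := EuclideanSpace ℝ (Fin n)

variable {n : ℕ}

/-- The boundary of the open set `Ω` is smooth: near each boundary point, `Ω` is the sublevel set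
`{ρ < 0}` of a smooth function `ρ` without critical points. -/
def HasSmoothBoundary (Ω : Set (Sp n)) : Prop :=
  ∀ x₀ ∈ frontier Ω, ∃ U : Set (Sp n), IsOpen U ∧ x₀ ∈ U ∧
    ∃ ρ : Sp n → ℝ, ContDiffOn ℝ ∞ ρ U ∧ (∀ x ∈ U, fderiv ℝ ρ x ≠ 0) ∧
      Ω ∩ U = {x ∈ U | ρ x < 0}

/-- A domain (nonempty open connected set) with smooth boundary. -/
structure IsSmoothDomain (Ω : Set (Sp n)) : Prop where
  isOpen : IsOpen Ω
  isConnected : IsConnected Ω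
  smoothBoundary : HasSmoothBoundary Ω

/-- `g ∈ C^∞(closure Ω; ℝ^{n×n})` is a uniformly elliptic Riemannian metric. -/
structure IsEllipticMetric (Ω : Set (Sp n)) (g : Sp n → Matrix (Fin n) (Fin n) ℝ) : Prop where
  smooth : ∀ i j, ContDiffOn ℝ ∞ (fun x => g x i j) (closure Ω)
  symm : ∀ x ∈ closure Ω, (g x).IsSymm
  elliptic : ∃ c : ℝ, 0 < c ∧ c < 1 ∧ ∀ x ∈ Ω, ∀ ξ : Fin n → ℝ,
    c * (ξ ⬝ᵥ ξ) ≤ ξ ⬝ᵥ (g x).mulVec ξ ∧ ξ ⬝ᵥ (g x).mulVec ξ ≤ c⁻¹ * (ξ ⬝ᵥ ξ)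

/-- `0 ≤ V ∈ C^∞(closure Ω)`. -/
structure IsPotential (Ω : Set (Sp n)) (V : Sp n → ℝ) : Prop where
  smooth : ContDiffOn ℝ ∞ V (closure Ω)
  nonneg : ∀ x ∈ closure Ω, 0 ≤ V x

/-- The Riemannian measure `dV_g = |g|^{1/2} dx` on `Ω`. -/
def vol (Ω : Set (Sp n)) (g : Sp n → Matrix (Fin n) (Fin n) ℝ) : Measure (Sp n) :=
  (volume.restrict Ω).withDensity fun x => ENNReal.ofReal (Real.sqrt (g x).det)

/-- The space `L²(Ω, dV_g)` of real functions. -/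
abbrev L2 (Ω : Set (Sp n)) (g : Sp n → Matrix (Fin n) (Fin n) ℝ) := Lp ℝ 2 (vol Ω g)

/-- The space of `L²` vector fields on `Ω`. Since `g` is uniformly elliptic, measuring vectors with
the Euclidean norm or with `g` gives equivalent norms. -/
abbrev L2Vec (Ω : Set (Sp n)) (g : Sp n → Matrix (Fin n) (Fin n) ℝ) := Lp (Sp n) 2 (vol Ω g)

/-- `φ ∈ C_c^∞(Ω)`, extended by zero to `ℝⁿ`. -/
structure IsTestFunction (Ω : Set (Sp n)) (φ : Sp n → ℝ) : Prop where
  smooth : ContDiff ℝ ∞ φ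
  compact : HasCompactSupport φ
  support : tsupport φ ⊆ Ω

/-- The space `H¹₀(Ω)`, as the set of pairs `(u, ∇u)`: the closure of the pairs `(φ, ∇φ)`,
`φ ∈ C_c^∞(Ω)`, in `L² × L²`, that is, the closure of `C_c^∞(Ω)` in the `H¹` norm. For a pair
`(u, G)` in this closure, `G` is the weak gradient of `u`. -/
def H10 (Ω : Set (Sp n)) (g : Sp n → Matrix (Fin n) (Fin n) ℝ) : Set (L2 Ω g × L2Vec Ω g) :=
  closure {p | ∃ φ : Sp n → ℝ, IsTestFunction Ω φ ∧
    p.1 =ᵐ[vol Ω g] φ ∧ p.2 =ᵐ[vol Ω g] gradient φ}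

/-- The graph of the Dirichlet realization `P = -Δ_g + V` on `L²(Ω, dV_g)`: `u ∈ Dom(P)` and
`P u = f`. That is, `u ∈ H¹₀(Ω)` and `-Δ_g u + V u = f ∈ L²` in the weak sense,
`∫ (g^{ij} ∂_i u ∂_j φ + V u φ) dV_g = ∫ f φ dV_g` for all `φ ∈ C_c^∞(Ω)`. -/
def IsP (Ω : Set (Sp n)) (g : Sp n → Matrix (Fin n) (Fin n) ℝ) (V : Sp n → ℝ)
    (u f : L2 Ω g) : Prop :=
  ∃ G : L2Vec Ω g, (u, G) ∈ H10 Ω g ∧ ∀ φ : Sp n → ℝ, IsTestFunction Ω φ →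
    ∫ x, ((∑ i, ∑ j, (g x)⁻¹ i j * G x i * gradient φ x j) + V x * u x * φ x) ∂(vol Ω g)
      = ∫ x, f x * φ x ∂(vol Ω g)

/-- `u(t) = e^{-tP} f`: the function `u ∈ C([0,∞); L²) ∩ C¹((0,∞); L²) ∩ C((0,∞); Dom(P))` solves
`u' + P u = 0` on `(0,∞)`, `u(0) = f`. -/
def IsHeatSolution (Ω : Set (Sp n)) (g : Sp n → Matrix (Fin n) (Fin n) ℝ) (V : Sp n → ℝ)
    (f : L2 Ω g) (u : ℝ → L2 Ω g) : Prop :=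
  ContinuousOn u (Ici 0) ∧ u 0 = f ∧
    ∃ Pu : ℝ → L2 Ω g, ContinuousOn Pu (Ioi 0) ∧
      ∀ t > 0, IsP Ω g V (u t) (Pu t) ∧ HasDerivAt u (-Pu t) t

/-- `K t x z` is the heat kernel `e^{-tP}(x,z)`: for each `t > 0` it is a bounded measurable
function on `Ω × Ω` (up to null sets), and `(e^{-tP} f)(x) = ∫_Ω K t x z f(z) dV_g(z)` for almost
every `x`, for all `f ∈ L²(Ω, dV_g)`. -/
structure IsHeatKernel (Ω : Set (Sp n)) (g : Sp n → Matrix (Fin n) (Fin n) ℝ) (V : Sp n → ℝ)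
    (K : ℝ → Sp n → Sp n → ℝ) : Prop where
  bounded : ∀ t > 0,
    MemLp (fun p : Sp n × Sp n => K t p.1 p.2) ⊤ ((vol Ω g).prod (vol Ω g))
  represents : ∀ f : L2 Ω g, ∃ u : ℝ → L2 Ω g, IsHeatSolution Ω g V f u ∧
    ∀ t > 0, u t =ᵐ[vol Ω g] fun x => ∫ z, K t x z * f z ∂(vol Ω g)

/-- `w` solves `(∂_t² + P) w = F` in `Ω × (0,∞)` with `w(0) = ∂_t w(0) = 0`, in the class
`w ∈ C([0,∞); Dom(P))`, `∂_t w ∈ C([0,∞); H¹₀(Ω))`, `∂_t² w ∈ C([0,∞); L²)`. Here `w'`, `w''` are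
the time derivatives (one-sided at `0`), `Pw t = P (w t)`, and `G' t` is the gradient of `w' t`. -/
def IsWaveSolution (Ω : Set (Sp n)) (g : Sp n → Matrix (Fin n) (Fin n) ℝ) (V : Sp n → ℝ)
    (F : Sp n × ℝ → ℝ) (w : ℝ → L2 Ω g) : Prop :=
  ∃ (w' w'' Pw : ℝ → L2 Ω g) (G' : ℝ → L2Vec Ω g),
    ContinuousOn w (Ici 0) ∧ ContinuousOn Pw (Ici 0) ∧
    ContinuousOn w' (Ici 0) ∧ ContinuousOn G' (Ici 0) ∧ ContinuousOn w'' (Ici 0) ∧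
    w 0 = 0 ∧ w' 0 = 0 ∧
    ∀ t ≥ 0,
      HasDerivWithinAt w (w' t) (Ici 0) t ∧ HasDerivWithinAt w' (w'' t) (Ici 0) t ∧
      IsP Ω g V (w t) (Pw t) ∧ (w' t, G' t) ∈ H10 Ω g ∧
      (w'' t + Pw t : L2 Ω g) =ᵐ[vol Ω g] fun x => F (x, t)

/-- The local source-to-solution map `F ↦ w^F|_{Γ × [0,∞)}` of the wave equation, written as the
set of all restrictions to `Γ × [0,∞)` of solutions with source `F` (so that its being
single-valued is a claim, not a convention). -/
def sourceToSolution (Ω Γ : Set (Sp n)) (g : Sp n → Matrix (Fin n) (Fin n) ℝ) (V : Sp n → ℝ)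
    (F : Sp n × ℝ → ℝ) : Set (ℝ≥0 → Lp ℝ 2 (volume.restrict Γ)) :=
  {r | ∃ w : ℝ → L2 Ω g, IsWaveSolution Ω g V F w ∧
    ∀ t : ℝ≥0, r t =ᵐ[volume.restrict Γ] w t}

end WaveHeat

end

/-! Formally w(t) = ∫₀ᵗ P^{-1/2} sin((t-s)P^{1/2}) F(s) ds is built from functions of P, so its
pairings with vectors supported in Γ should be determined by the pairings ⟨h, e^{-tP}f⟩ with h and f
supported in Γ. The proof realizes this without spectral calculus.

Let h be the indicator of a measurable subset of Γ and f a time slice of F. Since kernels and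
volumes agree on Γ, the numbers ⟨h, e^{-tP}f⟩ agree for the two operators (`kernel_pairing_eq`). The
resolvent J = (1 + εP)⁻¹ is a Laplace transform of the heat flow, Jf = ∫₀^∞ e^{-s} e^{-εsP}f ds
(`IsOrbit.resolvent_mem`), so the numbers ⟨h, Jᵐf⟩ agree, and with them ⟨h, Bᵐf⟩ for the Yosida
approximation B = ε⁻¹(1 - J) (`yosida_pow_pairing`). For bounded B, Duhamel's formula and the
exponential series express the wave through these moments (`boundedWave_pairing_eq`). As ε → 0 the
bounded waves converge to the wave of P (`exists_wave`), and the equality passes to the limit.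

Convergence rests on energy estimates. Since F is smooth in time and vanishes near t = 0, each time
derivative of the approximate wave solves an equation of the same form with zero data. Hence B
applied to these derivatives is bounded uniformly in ε, and the energy of the difference of two
approximations is O(ε + δ). Uniqueness is conservation of energy (`wave_unique`).

The Dirichlet operator comes from a closed coercive form (`exists_form`), which makes it closed,
symmetric and nonnegative. Surjectivity of 1 + εP is read off from the heat flow that the heat
kernel supplies for every initial datum (`isNonnegSelfAdjoint_of_orbits`). -/

noncomputable section

namespace WaveHeat

open Filter Topology

/-! ### Resolvents and Yosida approximations. -/

section Abstract

variable {H : Type*} [NormedAddCommGroup H] [InnerProductSpace ℝ H]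

/-- The graph of a nonnegative self-adjoint operator on a real Hilbert space. Self-adjointness is
expressed by symmetry together with surjectivity of `1 + ε P` for all `ε > 0`. -/
structure IsNonnegSelfAdjoint (P : Submodule ℝ (H × H)) : Prop where
  closed : IsClosed (P : Set (H × H))
  symm : ∀ p ∈ P, ∀ q ∈ P, inner ℝ p.2 q.1 = inner ℝ p.1 q.2
  nonneg : ∀ p ∈ P, 0 ≤ inner ℝ p.2 p.1
  range : ∀ ε : ℝ, 0 < ε → ∀ x, ∃ y, (y, ε⁻¹ • (x - y)) ∈ P

/-- `J` is the resolvent `(1 + ε P)⁻¹`. -/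
def IsResolvent (P : Submodule ℝ (H × H)) (ε : ℝ) (J : H →L[ℝ] H) : Prop :=
  ∀ x, (J x, ε⁻¹ • (x - J x)) ∈ P

/-- The Yosida approximation `ε⁻¹ (1 - J)`. -/
def yosida (ε : ℝ) (J : H →L[ℝ] H) : H →L[ℝ] H := ε⁻¹ • (ContinuousLinearMap.id ℝ H - J)

lemma yosida_apply (ε : ℝ) (J : H →L[ℝ] H) (x : H) : yosida ε J x = ε⁻¹ • (x - J x) := rfl

variable {P : Submodule ℝ (H × H)} {ε : ℝ}

lemma norm_le_of_resolvent (hP : IsNonnegSelfAdjoint P) (hε : 0 < ε) {x y : H}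
    (h : (y, ε⁻¹ • (x - y)) ∈ P) : ‖y‖ ≤ ‖x‖ := by
  have h1 := hP.nonneg _ h
  simp only [inner_smul_left, inner_sub_left, real_inner_self_eq_norm_sq] at h1
  have h2 : 0 ≤ inner ℝ x y - ‖y‖ ^ 2 :=
    nonneg_of_mul_nonneg_right h1 (by simpa using hε)
  have h3 := real_inner_le_norm x y
  by_contra! h4
  have : 0 < ‖y‖ := (norm_nonneg x).trans_lt h4
  nlinarith

lemma eq_of_resolvent (hP : IsNonnegSelfAdjoint P) (hε : 0 < ε) {x y z : H}
    (hy : (y, ε⁻¹ • (x - y)) ∈ P) (hz : (z, ε⁻¹ • (x - z)) ∈ P) : y = z := by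
  have h := P.sub_mem hy hz
  have h1 : (y - z, ε⁻¹ • ((0 : H) - (y - z))) ∈ P := by
    convert h using 1
    ext
    · rfl
    · simp [← smul_sub]
  have := norm_le_of_resolvent hP hε h1
  rw [norm_zero, norm_le_zero_iff, sub_eq_zero] at this
  exact this

lemma exists_resolvent (hP : IsNonnegSelfAdjoint P) (hε : 0 < ε) :
    ∃ J : H →L[ℝ] H, IsResolvent P ε J := by
  choose J hJ using hP.range ε hε
  refine ⟨LinearMap.mkContinuous
    { toFun := J
      map_add' := fun x y => eq_of_resolvent hP hε (hJ _) ?_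
      map_smul' := fun c x => eq_of_resolvent hP hε (hJ _) ?_ } 1 fun x => ?_, hJ⟩
  · convert P.add_mem (hJ x) (hJ y) using 1
    ext
    · rfl
    · simp [← smul_add, add_sub_add_comm]
  · convert P.smul_mem c (hJ x) using 1
    ext
    · rfl
    · simp [smul_comm c, smul_sub]
  · simpa using norm_le_of_resolvent hP hε (hJ x)

lemma IsResolvent.add_smul_yosida {J : H →L[ℝ] H} (hε : 0 < ε) (x : H) :
    J x + ε • yosida ε J x = x := by
  simp [yosida_apply, smul_smul, hε.ne']

/-- Writing B for the Yosida approximation, (Jx, Bx) lies in P and y = Jy + εBy. So ⟨Bx, y⟩ = ⟨Bx,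
Jy⟩ + ε⟨Bx, By⟩, and both terms are symmetric in x and y. -/
lemma IsResolvent.yosida_symm (hP : IsNonnegSelfAdjoint P) (hε : 0 < ε) {J : H →L[ℝ] H}
    (hJ : IsResolvent P ε J) (x y : H) :
    inner ℝ (yosida ε J x) y = inner ℝ x (yosida ε J y) := by
  have h := hP.symm _ (hJ x) _ (hJ y)
  simp only [← yosida_apply] at h
  conv_lhs => rw [← IsResolvent.add_smul_yosida (J := J) hε y]
  conv_rhs => rw [← IsResolvent.add_smul_yosida (J := J) hε x]
  simp only [inner_add_right, inner_add_left, inner_smul_left, inner_smul_right, h]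
  simp

lemma IsResolvent.yosida_nonneg (hP : IsNonnegSelfAdjoint P) (hε : 0 < ε) {J : H →L[ℝ] H}
    (hJ : IsResolvent P ε J) (x : H) : 0 ≤ inner ℝ (yosida ε J x) x := by
  have h := hP.nonneg _ (hJ x)
  simp only [← yosida_apply] at h
  have h2 : inner ℝ (yosida ε J x) x
      = inner ℝ (yosida ε J x) (J x) + ε * inner ℝ (yosida ε J x) (yosida ε J x) := by
    rw [← inner_smul_right, ← inner_add_right, IsResolvent.add_smul_yosida hε]
  rw [h2]
  exact add_nonneg h (mul_nonneg hε.le real_inner_self_nonneg)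

end Abstract

/-! ### Duhamel's formula for bounded generators. -/

section Duhamel

variable {E : Type*} [NormedAddCommGroup E] [NormedSpace ℝ E]

/-- The solution of `z' = A z + g`, `z 0 = 0`, for a bounded operator `A`. -/
def duhamel (A : E →L[ℝ] E) (g : ℝ → E) (t : ℝ) : E :=
  NormedSpace.exp (t • A) (∫ s in (0 : ℝ)..t, NormedSpace.exp ((-s) • A) (g s))

lemma duhamel_of_nonpos (A : E →L[ℝ] E) {g : ℝ → E} (hg : ∀ t ≤ 0, g t = 0) {t : ℝ}
    (ht : t ≤ 0) : duhamel A g t = 0 := by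
  rw [duhamel, intervalIntegral.integral_congr (g := fun _ => 0), intervalIntegral.integral_zero,
    map_zero]
  intro s hs
  rw [uIcc_of_ge ht] at hs
  simp [hg s hs.2]

variable [CompleteSpace E]

lemma continuous_exp_neg_apply (A : E →L[ℝ] E) {g : ℝ → E} (hg : Continuous g) :
    Continuous fun s : ℝ => NormedSpace.exp ((-s) • A) (g s) := by
  have h1 : Continuous fun s : ℝ => NormedSpace.exp (s • A) :=
    continuous_iff_continuousAt.2 fun t => (hasDerivAt_exp_smul_const A t).continuousAt
  have h2 : Continuous fun s : ℝ => NormedSpace.exp ((-s) • A) := h1.comp continuous_neg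
  exact h2.clm_apply hg

lemma exp_sub_smul (A : E →L[ℝ] E) (t s : ℝ) :
    NormedSpace.exp ((t - s) • A) = NormedSpace.exp (t • A) * NormedSpace.exp ((-s) • A) := by
  have : NormedAlgebra ℚ (E →L[ℝ] E) := NormedAlgebra.restrictScalars ℚ ℝ _
  rw [← NormedSpace.exp_add_of_commute, ← add_smul, sub_eq_add_neg]
  exact ((Commute.refl _).smul_left _).smul_right _

lemma duhamel_hasDerivAt (A : E →L[ℝ] E) {g : ℝ → E} (hg : Continuous g) (t : ℝ) :
    HasDerivAt (duhamel A g) (A (duhamel A g t) + g t) t := by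
  have hc := continuous_exp_neg_apply A hg
  have h1 := (hasDerivAt_exp_smul_const' (𝕂 := ℝ) A t).clm_apply
    (hc.integral_hasStrictDerivAt 0 t).hasDerivAt
  refine h1.congr_deriv ?_
  have h2 := exp_sub_smul A t t
  rw [sub_self, zero_smul, NormedSpace.exp_zero] at h2
  have h3 := congrArg (fun T : E →L[ℝ] E => T (g t)) h2
  simp only [mul_apply_eq_comp, one_apply_eq_self] at h3
  rw [← h3, mul_apply_eq_comp, ← duhamel]

/-- The scalar series shows that an observation of the flow depends only on the moments `L ((A ^ k)
z)`, which can be compared between different spaces. -/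
lemma hasSum_exp_smul (A : E →L[ℝ] E) (L : E →L[ℝ] ℝ) (τ : ℝ) (z : E) :
    HasSum (fun k : ℕ => ((k.factorial : ℝ)⁻¹ * τ ^ k) * L ((A ^ k) z))
      (L (NormedSpace.exp (τ • A) z)) := by
  have h1 := (L.comp (ContinuousLinearMap.apply ℝ E z)).hasSum
    (NormedSpace.exp_series_hasSum_exp' (𝕂 := ℝ) (τ • A))
  refine h1.congr_fun fun k => ?_
  simp [smul_pow, mul_assoc]

lemma apply_duhamel (A : E →L[ℝ] E) (L : E →L[ℝ] ℝ) {g : ℝ → E} (hg : Continuous g) (t : ℝ) :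
    L (duhamel A g t) = ∫ s in (0 : ℝ)..t, L (NormedSpace.exp ((t - s) • A) (g s)) := by
  have h1 := (L.comp (NormedSpace.exp (t • A))).intervalIntegral_comp_comm
    ((continuous_exp_neg_apply A hg).intervalIntegrable (μ := volume) 0 t)
  rw [duhamel, ← ContinuousLinearMap.comp_apply, ← h1]
  refine intervalIntegral.integral_congr fun s _ => ?_
  simp only [exp_sub_smul]
  rfl

lemma apply_duhamel_eq {E' : Type*} [NormedAddCommGroup E'] [NormedSpace ℝ E'] [CompleteSpace E']
    {A : E →L[ℝ] E} {A' : E' →L[ℝ] E'} {L : E →L[ℝ] ℝ} {L' : E' →L[ℝ] ℝ} {g : ℝ → E} {g' : ℝ → E'}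
    (hg : Continuous g) (hg' : Continuous g')
    (h : ∀ (k : ℕ) (s : ℝ), L ((A ^ k) (g s)) = L' ((A' ^ k) (g' s))) (t : ℝ) :
    L (duhamel A g t) = L' (duhamel A' g' t) := by
  rw [apply_duhamel A L hg, apply_duhamel A' L' hg']
  refine intervalIntegral.integral_congr fun s _ => ?_
  refine (hasSum_exp_smul A L (t - s) _).unique ?_
  refine (hasSum_exp_smul A' L' (t - s) _).congr_fun fun k => ?_
  rw [h]

end Duhamel

/-! ### The wave equation of a bounded operator and its moments. -/

section Abstract

variable {H : Type*} [NormedAddCommGroup H] [InnerProductSpace ℝ H]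

/-- The generator of the first order system for `w'' + B w = 0`. -/
def waveGen (B : H →L[ℝ] H) : (H × H) →L[ℝ] (H × H) :=
  (ContinuousLinearMap.snd ℝ H H).prod (-(B.comp (ContinuousLinearMap.fst ℝ H H)))

lemma waveGen_apply (B : H →L[ℝ] H) (z : H × H) : waveGen B z = (z.2, -B z.1) := rfl

/-- The pair `(w, w')` for the solution of `w'' + B w = f` with zero initial data, for a bounded
operator `B`. -/
def boundedWave (B : H →L[ℝ] H) (f : ℝ → H) (t : ℝ) : H × H :=
  duhamel (waveGen B) (fun s => ((0 : H), f s)) t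

lemma boundedWave_of_nonpos (B : H →L[ℝ] H) {f : ℝ → H} (hf : ∀ t ≤ 0, f t = 0) {t : ℝ}
    (ht : t ≤ 0) : boundedWave B f t = 0 :=
  duhamel_of_nonpos _ (fun s hs => by simp [hf s hs]) ht

lemma boundedWave_hasDerivAt [CompleteSpace H] (B : H →L[ℝ] H) {f : ℝ → H} (hf : Continuous f)
    (t : ℝ) :
    HasDerivAt (boundedWave B f)
      ((boundedWave B f t).2, f t - B (boundedWave B f t).1) t := by
  refine (duhamel_hasDerivAt (waveGen B) (g := fun s => ((0 : H), f s)) (by fun_prop)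
    t).congr_deriv ?_
  rw [← boundedWave, waveGen_apply]
  ext <;> simp [sub_eq_neg_add]

variable {H₁ H₂ : Type*} [NormedAddCommGroup H₁] [InnerProductSpace ℝ H₁]
  [NormedAddCommGroup H₂] [InnerProductSpace ℝ H₂]

/-- The generator sends (a, b) to (b, -Ba). Agreement of all B-moments of both components therefore
survives each application, which is why the induction carries both components. -/
lemma waveGen_pow_pairing {B₁ : H₁ →L[ℝ] H₁} {B₂ : H₂ →L[ℝ] H₂} {h₁ : H₁} {h₂ : H₂} (k : ℕ) :
    ∀ {z₁ : H₁ × H₁} {z₂ : H₂ × H₂},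
    (∀ m : ℕ, inner ℝ h₁ ((B₁ ^ m) z₁.1) = inner ℝ h₂ ((B₂ ^ m) z₂.1)) →
    (∀ m : ℕ, inner ℝ h₁ ((B₁ ^ m) z₁.2) = inner ℝ h₂ ((B₂ ^ m) z₂.2)) →
    inner ℝ h₁ ((waveGen B₁ ^ k) z₁).1 = inner ℝ h₂ ((waveGen B₂ ^ k) z₂).1 := by
  induction k with
  | zero => intro z₁ z₂ h _; simpa using h 0
  | succ k ih =>
    intro z₁ z₂ ha hb
    simp only [pow_succ, mul_apply_eq_comp]
    refine ih (fun m => ?_) (fun m => ?_)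
    · simpa [waveGen_apply] using hb m
    · simpa [waveGen_apply, pow_succ] using ha (m + 1)

/-- The pairing of the bounded wave with a vector depends only on the moments of the source. -/
lemma boundedWave_pairing_eq [CompleteSpace H₁] [CompleteSpace H₂]
    {B₁ : H₁ →L[ℝ] H₁} {B₂ : H₂ →L[ℝ] H₂} {h₁ : H₁} {h₂ : H₂}
    {f₁ : ℝ → H₁} {f₂ : ℝ → H₂} (hf₁ : Continuous f₁) (hf₂ : Continuous f₂)
    (hB : ∀ (m : ℕ) (s : ℝ), inner ℝ h₁ ((B₁ ^ m) (f₁ s)) = inner ℝ h₂ ((B₂ ^ m) (f₂ s))) (t : ℝ) :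
    inner ℝ h₁ (boundedWave B₁ f₁ t).1 = inner ℝ h₂ (boundedWave B₂ f₂ t).1 :=
  apply_duhamel_eq (A := waveGen B₁) (A' := waveGen B₂) (g := fun s => ((0 : H₁), f₁ s))
    (g' := fun s => ((0 : H₂), f₂ s))
    (L := (innerSL ℝ h₁).comp (ContinuousLinearMap.fst ℝ H₁ H₁))
    (L' := (innerSL ℝ h₂).comp (ContinuousLinearMap.fst ℝ H₂ H₂)) (by fun_prop) (by fun_prop)
    (fun k s => waveGen_pow_pairing k (by simp) fun m => hB m s) t

end Abstract
-- Energy estimates, uniqueness and existence for the abstract wave equation.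
lemma le_exp_mul_of_hasDerivAt {h h' : ℝ → ℝ} {c T : ℝ} (hc : 0 ≤ c) (h0 : h 0 ≤ 0)
    (hd : ∀ t, HasDerivAt h (h' t) t) (hle : ∀ t ∈ Icc 0 T, h' t ≤ h t + c) :
    ∀ t ∈ Icc 0 T, h t ≤ Real.exp T * (c * T) := by
  intro t ht
  -- Grönwall with integrating factor e^{-s}: this function is nonincreasing on [0, T].
  have hk : ∀ s, HasDerivAt (fun s => Real.exp (-s) * h s - c * s)
      (Real.exp (-s) * (h' s - h s) - c) s := by
    intro s
    have h1 := (((hasDerivAt_id s).neg.exp.mul (hd s)).sub ((hasDerivAt_id s).const_mul c))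
    refine h1.congr_deriv ?_
    simp
    ring
  have hanti : AntitoneOn (fun s => Real.exp (-s) * h s - c * s) (Icc 0 T) := by
    refine antitoneOn_of_deriv_nonpos (convex_Icc 0 T)
      (fun s _ => (hk s).continuousAt.continuousWithinAt)
      (fun s _ => (hk s).differentiableAt.differentiableWithinAt) fun s hs => ?_
    rw [interior_Icc] at hs
    rw [(hk s).deriv]
    have h1 := hle s ⟨hs.1.le, hs.2.le⟩
    have h2 : Real.exp (-s) ≤ 1 := Real.exp_le_one_iff.2 (by linarith [hs.1])
    nlinarith [Real.exp_pos (-s)]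
  have h1 := hanti (left_mem_Icc.2 (ht.1.trans ht.2)) ht ht.1
  simp only [neg_zero, Real.exp_zero, one_mul, mul_zero, sub_zero] at h1
  have h2 : Real.exp (-t) * h t ≤ c * T := by nlinarith [ht.2]
  have h3 : h t = Real.exp t * (Real.exp (-t) * h t) := by
    rw [← mul_assoc, ← Real.exp_add]; simp
  rw [h3]
  have hT : 0 ≤ c * T := mul_nonneg hc (ht.1.trans ht.2)
  calc _ ≤ Real.exp t * (c * T) := by gcongr
    _ ≤ _ := by gcongr; exact ht.2

section Abstract

variable {H : Type*} [NormedAddCommGroup H] [InnerProductSpace ℝ H]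

/-- `f` is a sequence of successive derivatives of a function which vanishes for negative times. -/
structure IsSource (f : ℕ → ℝ → H) : Prop where
  hasDerivAt : ∀ k t, HasDerivAt (f k) (f (k + 1) t) t
  of_nonpos : ∀ k, ∀ t ≤ 0, f k t = 0

lemma IsSource.continuous {f : ℕ → ℝ → H} (hf : IsSource f) (k : ℕ) : Continuous (f k) :=
  continuous_iff_continuousAt.2 fun t => (hf.hasDerivAt k t).continuousAt

lemma IsSource.exists_bound {f : ℕ → ℝ → H} (hf : IsSource f) (k : ℕ) (T : ℝ) :
    ∃ M, 0 ≤ M ∧ ∀ t ≤ T, ‖f k t‖ ≤ M := by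
  obtain ⟨M, hM⟩ := isCompact_Icc.exists_bound_of_continuousOn (s := Icc 0 T)
    (hf.continuous k).continuousOn
  refine ⟨max M 0, le_max_right _ _, fun t ht => ?_⟩
  rcases le_total t 0 with h | h
  · simp [hf.of_nonpos k t h]
  · exact (hM t ⟨h, ht⟩).trans (le_max_left _ _)

/-- The successive time derivatives of the solution of `w'' + B w = f 0`. -/
def waveDeriv (B : H →L[ℝ] H) (f : ℕ → ℝ → H) : ℕ → ℝ → H
  | 0 => fun t => (boundedWave B (f 0) t).1
  | 1 => fun t => (boundedWave B (f 0) t).2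
  | k + 2 => fun t => f k t - B (waveDeriv B f k t)

lemma waveDeriv_add_two (B : H →L[ℝ] H) (f : ℕ → ℝ → H) (k : ℕ) (t : ℝ) :
    waveDeriv B f (k + 2) t = f k t - B (waveDeriv B f k t) := rfl

lemma waveDeriv_of_nonpos (B : H →L[ℝ] H) {f : ℕ → ℝ → H} (hf : IsSource f) :
    ∀ k, ∀ t ≤ 0, waveDeriv B f k t = 0
  | 0, t, ht => by simp [waveDeriv, boundedWave_of_nonpos B (hf.of_nonpos 0) ht]
  | 1, t, ht => by simp [waveDeriv, boundedWave_of_nonpos B (hf.of_nonpos 0) ht]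
  | k + 2, t, ht => by
    simp [waveDeriv_add_two, waveDeriv_of_nonpos B hf k t ht, hf.of_nonpos k t ht]

variable {P : Submodule ℝ (H × H)}

/-- Uniqueness for the abstract wave equation. -/
theorem wave_unique (hP : IsNonnegSelfAdjoint P) {w w' w'' : ℝ → H}
    (hw''c : ContinuousOn w'' (Ici 0)) (hw0 : w 0 = 0) (hw'0 : w' 0 = 0)
    (hw : ∀ t ≥ 0, HasDerivWithinAt w (w' t) (Ici 0) t)
    (hw' : ∀ t ≥ 0, HasDerivWithinAt w' (w'' t) (Ici 0) t)
    (hwP : ∀ t ≥ 0, (w t, -w'' t) ∈ P) : ∀ t ≥ 0, w t = 0 := by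
  -- Here -w'' = Pw is only continuous, so the product rule is unavailable. Symmetry gives ⟨Pw(s),
  -- w(s)⟩ - ⟨Pw(t), w(t)⟩ = ⟨Pw(s) + Pw(t), w(s) - w(t)⟩, whose difference quotient converges.
  have hq : ∀ t ≥ 0, HasDerivWithinAt (fun s => inner ℝ (-w'' s) (w s))
      (2 * inner ℝ (-w'' t) (w' t)) (Ici 0) t := by
    intro t ht
    rw [hasDerivWithinAt_iff_tendsto_slope]
    have h1 : Tendsto (fun s => inner ℝ (-w'' s + -w'' t) (slope w t s)) (𝓝[Ici 0 \ {t}] t)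
        (𝓝 (inner ℝ (-w'' t + -w'' t) (w' t))) := by
      refine Tendsto.inner ?_ ((hasDerivWithinAt_iff_tendsto_slope).1 (hw t ht))
      exact (((hw''c t ht).mono_left (nhdsWithin_mono t sdiff_subset)).neg).add_const _
    rw [inner_add_left, ← two_mul] at h1
    refine h1.congr' ?_
    filter_upwards [self_mem_nhdsWithin] with s hs
    have h2 := hP.symm _ (hwP s hs.1) _ (hwP t ht)
    simp only at h2
    simp only [slope, vsub_eq_sub, inner_smul_right, inner_sub_right, inner_add_left, h2, smul_eq_mul]
    rw [real_inner_comm (w s) (-w'' s), real_inner_comm (w s) (-w'' t)]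
    ring
  have hE : ∀ t ≥ 0, HasDerivWithinAt (fun s => inner ℝ (w' s) (w' s) + inner ℝ (-w'' s) (w s))
      0 (Ici 0) t := by
    intro t ht
    refine (((hw' t ht).inner ℝ (hw' t ht)).add (hq t ht)).congr_deriv ?_
    rw [real_inner_comm (w'' t), inner_neg_left]
    ring
  have hw'z : ∀ t ≥ 0, w' t = 0 := by
    intro t ht
    have h1 := constant_of_derivWithin_zero (a := 0) (b := t)
      (fun s hs => ((hE s hs.1).mono Icc_subset_Ici_self).differentiableWithinAt)
      (fun s hs => by
        refine HasDerivWithinAt.derivWithin ((hE s hs.1).mono Icc_subset_Ici_self) ?_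
        exact uniqueDiffOn_Icc (hs.1.trans_lt hs.2) s ⟨hs.1, hs.2.le⟩) t (right_mem_Icc.2 ht)
    simp only [hw0, hw'0, inner_zero_right, add_zero] at h1
    have h2 := hP.nonneg _ (hwP t ht)
    simp only at h2
    have h3 : inner ℝ (w' t) (w' t) = (0 : ℝ) :=
      le_antisymm (by linarith) real_inner_self_nonneg
    exact inner_self_eq_zero.1 h3
  intro t ht
  have h1 := constant_of_derivWithin_zero (a := 0) (b := t) (f := w)
      (fun s hs => ((hw s hs.1).mono Icc_subset_Ici_self).differentiableWithinAt)
      (fun s hs => by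
        rw [HasDerivWithinAt.derivWithin ((hw s hs.1).mono Icc_subset_Ici_self)
          (uniqueDiffOn_Icc (hs.1.trans_lt hs.2) s ⟨hs.1, hs.2.le⟩), hw'z s hs.1])
      t (right_mem_Icc.2 ht)
  rw [h1, hw0]

variable [CompleteSpace H]

lemma waveDeriv_hasDerivAt (B : H →L[ℝ] H) {f : ℕ → ℝ → H} (hf : IsSource f) :
    ∀ k t, HasDerivAt (waveDeriv B f k) (waveDeriv B f (k + 1) t) t
  | 0, t => ((boundedWave_hasDerivAt B (hf.continuous 0) t).hasFDerivAt.fst).hasDerivAt.congr_deriv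
      (by simp [waveDeriv])
  | 1, t => ((boundedWave_hasDerivAt B (hf.continuous 0) t).hasFDerivAt.snd).hasDerivAt.congr_deriv
      (by simp [waveDeriv])
  | k + 2, t => (hf.hasDerivAt k t).sub
      (B.hasFDerivAt.comp_hasDerivAt t (waveDeriv_hasDerivAt B hf k t))

/-- The energy ‖x₍ₖ₊₁₎‖² + ⟨Bxₖ, xₖ⟩ has derivative 2⟨fₖ, x₍ₖ₊₁₎⟩, at most the energy plus M². Only
symmetry and nonnegativity of B enter, so the bound does not depend on ε. -/
lemma waveDeriv_energy_bound (hP : IsNonnegSelfAdjoint P) {f : ℕ → ℝ → H} (hf : IsSource f)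
    (k : ℕ) (T : ℝ) : ∃ C, 0 ≤ C ∧ ∀ ε > 0, ∀ J, IsResolvent P ε J → ∀ t ≤ T,
      ‖waveDeriv (yosida ε J) f (k + 1) t‖ ≤ C := by
  obtain ⟨M, hM0, hM⟩ := hf.exists_bound k T
  refine ⟨√(Real.exp T * (M ^ 2 * T)), Real.sqrt_nonneg _, fun ε hε J hJ t ht => ?_⟩
  set B := yosida ε J
  set x := waveDeriv B f
  rcases le_total t 0 with h0 | h0
  · simp [x, waveDeriv_of_nonpos B hf (k + 1) t h0]
  refine Real.le_sqrt_of_sq_le ?_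
  have hx := waveDeriv_hasDerivAt B hf
  have hE : ∀ t, HasDerivAt
      (fun t => inner ℝ (x (k + 1) t) (x (k + 1) t) + inner ℝ (B (x k t)) (x k t))
      (2 * inner ℝ (f k t) (x (k + 1) t)) t := by
    intro t
    have h1 := ((hx (k + 1) t).inner ℝ (hx (k + 1) t)).add
      ((B.hasFDerivAt.comp_hasDerivAt t (hx k t)).inner ℝ (hx k t))
    refine h1.congr_deriv ?_
    have h2 : waveDeriv B f (k + 1 + 1) t = f k t - B (x k t) := rfl
    have h3 : inner ℝ (B (x (k + 1) t)) (x k t) = inner ℝ (x (k + 1) t) (B (x k t)) :=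
      IsResolvent.yosida_symm hP hε hJ _ _
    rw [h2, h3]
    simp only [inner_sub_left, inner_sub_right, Function.comp, real_inner_comm (B (x k t)),
      real_inner_comm (f k t), x]
    ring
  have key := le_exp_mul_of_hasDerivAt (c := M ^ 2) (T := T) (by positivity)
    (by simp [x, waveDeriv_of_nonpos B hf _ 0 le_rfl]) hE (fun s hs => ?_) t ⟨h0, ht⟩
  · rw [real_inner_self_eq_norm_sq] at key
    linarith [IsResolvent.yosida_nonneg hP hε hJ (x k t)]
  · have h1 := real_inner_le_norm (f k s) (x (k + 1) s)
    have h2 := hM s hs.2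
    rw [real_inner_self_eq_norm_sq]
    have h3 := IsResolvent.yosida_nonneg hP hε hJ (x k s)
    change 0 ≤ inner ℝ (B (x k s)) (x k s) at h3
    nlinarith [sq_nonneg (‖f k s‖ - ‖x (k + 1) s‖), norm_nonneg (f k s)]

lemma yosida_waveDeriv_bound (hP : IsNonnegSelfAdjoint P) {f : ℕ → ℝ → H} (hf : IsSource f)
    (k : ℕ) (T : ℝ) : ∃ C, 0 ≤ C ∧ ∀ ε > 0, ∀ J, IsResolvent P ε J → ∀ t ≤ T,
      ‖yosida ε J (waveDeriv (yosida ε J) f k t)‖ ≤ C := by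
  obtain ⟨M, hM0, hM⟩ := hf.exists_bound k T
  obtain ⟨C, hC0, hC⟩ := waveDeriv_energy_bound hP hf (k + 1) T
  refine ⟨M + C, by positivity, fun ε hε J hJ t ht => ?_⟩
  have h1 : yosida ε J (waveDeriv (yosida ε J) f k t)
      = f k t - waveDeriv (yosida ε J) f (k + 1 + 1) t := by
    simp [waveDeriv_add_two]
  rw [h1]
  exact (norm_sub_le _ _).trans (add_le_add (hM t ht) (hC ε hε J hJ t ht))

/-- The pair (Jx - Kz, Bx - Az) lies in P, so ⟨Bx - Az, Jx - Kz⟩ is a nonnegative potential energy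
for the difference. Because x = Jx + εBx and z = Kz + δAz, the total energy fails to be conserved
only through terms carrying a factor ε or δ. -/
lemma waveDeriv_succ_cauchy (hP : IsNonnegSelfAdjoint P) {f : ℕ → ℝ → H} (hf : IsSource f)
    (k : ℕ) (T : ℝ) : ∃ C, 0 ≤ C ∧ ∀ ε > 0, ∀ J, IsResolvent P ε J →
      ∀ δ > 0, ∀ K, IsResolvent P δ K → ∀ t ≤ T,
      ‖waveDeriv (yosida ε J) f (k + 1) t - waveDeriv (yosida δ K) f (k + 1) t‖
        ≤ √(C * (ε + δ)) := by
  obtain ⟨C₀, hC₀, hC₀'⟩ := yosida_waveDeriv_bound hP hf k T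
  obtain ⟨C₁, hC₁, hC₁'⟩ := yosida_waveDeriv_bound hP hf (k + 1) T
  -- The energy derivative is twice an inner product of vectors of norm at most 2C₀ and (ε + δ)C₁.
  -- The absolute value keeps the constant nonnegative for negative T.
  refine ⟨Real.exp T * (4 * C₀ * C₁ * |T|), by positivity, fun ε hε J hJ δ hδ K hK t ht => ?_⟩
  set B := yosida ε J
  set A := yosida δ K
  set x := waveDeriv B f
  set z := waveDeriv A f
  rcases le_total t 0 with h0 | h0
  · simp [x, z, waveDeriv_of_nonpos _ hf (k + 1) t h0]
  refine Real.le_sqrt_of_sq_le ?_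
  have hx := waveDeriv_hasDerivAt B hf
  have hz := waveDeriv_hasDerivAt A hf
  have hmem : ∀ l t, (J (x l t) - K (z l t), B (x l t) - A (z l t)) ∈ P := fun l t =>
    P.sub_mem (hJ (x l t)) (hK (z l t))
  have hE : ∀ t, HasDerivAt
      (fun t => inner ℝ (x (k + 1) t - z (k + 1) t) (x (k + 1) t - z (k + 1) t)
        + inner ℝ (B (x k t) - A (z k t)) (J (x k t) - K (z k t)))
      (-(2 * inner ℝ (B (x k t) - A (z k t)) (ε • B (x (k + 1) t) - δ • A (z (k + 1) t)))) t := by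
    intro t
    have hd := (hx (k + 1) t).sub (hz (k + 1) t)
    have hp := (B.hasFDerivAt.comp_hasDerivAt t (hx k t)).sub
      (A.hasFDerivAt.comp_hasDerivAt t (hz k t))
    have hy := (J.hasFDerivAt.comp_hasDerivAt t (hx k t)).sub
      (K.hasFDerivAt.comp_hasDerivAt t (hz k t))
    have h1 := (hd.inner ℝ hd).add (hp.inner ℝ hy)
    refine h1.congr_deriv ?_
    have e1 : waveDeriv B f (k + 1 + 1) t - waveDeriv A f (k + 1 + 1) t
        = -(B (x k t) - A (z k t)) := by
      simp only [waveDeriv_add_two, x, z]; abel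
    have e2 : x (k + 1) t - z (k + 1) t = (J (x (k + 1) t) - K (z (k + 1) t))
        + (ε • B (x (k + 1) t) - δ • A (z (k + 1) t)) := by
      conv_lhs => rw [← IsResolvent.add_smul_yosida (J := J) hε (x (k + 1) t),
        ← IsResolvent.add_smul_yosida (J := K) hδ (z (k + 1) t)]
      simp only [B, A]; abel
    have e3 := hP.symm _ (hmem (k + 1) t) _ (hmem k t)
    simp only [Pi.sub_apply, Function.comp]
    change _ + (inner ℝ (B (x k t) - A (z k t)) (J (x (k + 1) t) - K (z (k + 1) t))
      + inner ℝ (B (x (k + 1) t) - A (z (k + 1) t)) (J (x k t) - K (z k t))) = _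
    rw [e3, e1, real_inner_comm (-(B (x k t) - A (z k t)))]
    change inner ℝ (-(B (x k t) - A (z k t))) (x (k + 1) t - z (k + 1) t)
      + inner ℝ (-(B (x k t) - A (z k t))) (x (k + 1) t - z (k + 1) t) + _ = _
    rw [e2, inner_neg_left, inner_add_right, real_inner_comm (B (x k t) - A (z k t))
      (J (x (k + 1) t) - K (z (k + 1) t))]
    ring
  have key := le_exp_mul_of_hasDerivAt (c := 4 * C₀ * C₁ * (ε + δ)) (T := T) (by positivity)
    (by simp [x, z, waveDeriv_of_nonpos _ hf _ 0 le_rfl]) hE (fun s hs => ?_) t ⟨h0, ht⟩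
  · rw [real_inner_self_eq_norm_sq] at key
    have h1 := hP.nonneg _ (hmem k t)
    rw [abs_of_nonneg (h0.trans ht)]
    simp only at h1
    linarith
  · have h1 := hP.nonneg _ (hmem k s)
    have h2 : (0 : ℝ) ≤ inner ℝ (x (k + 1) s - z (k + 1) s) (x (k + 1) s - z (k + 1) s) :=
      real_inner_self_nonneg
    have h3 := abs_real_inner_le_norm (B (x k s) - A (z k s))
      (ε • B (x (k + 1) s) - δ • A (z (k + 1) s))
    have h4 : ‖B (x k s) - A (z k s)‖ ≤ C₀ + C₀ := (norm_sub_le _ _).trans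
      (add_le_add (hC₀' ε hε J hJ s hs.2) (hC₀' δ hδ K hK s hs.2))
    have h5 : ‖ε • B (x (k + 1) s) - δ • A (z (k + 1) s)‖ ≤ ε * C₁ + δ * C₁ := by
      refine (norm_sub_le _ _).trans (add_le_add ?_ ?_)
      · rw [norm_smul, Real.norm_of_nonneg hε.le]
        exact mul_le_mul_of_nonneg_left (hC₁' ε hε J hJ s hs.2) hε.le
      · rw [norm_smul, Real.norm_of_nonneg hδ.le]
        exact mul_le_mul_of_nonneg_left (hC₁' δ hδ K hK s hs.2) hδ.le
    have h6 := (h3.trans (mul_le_mul h4 h5 (norm_nonneg _) (by positivity)))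
    have h7 := neg_le_of_abs_le h6
    simp only at h1
    nlinarith

lemma waveDeriv_cauchy (hP : IsNonnegSelfAdjoint P) {f : ℕ → ℝ → H} (hf : IsSource f) :
    ∀ (k : ℕ) (T : ℝ), ∃ C, 0 ≤ C ∧ ∀ ε > 0, ∀ J, IsResolvent P ε J →
      ∀ δ > 0, ∀ K, IsResolvent P δ K → ∀ t ≤ T,
      ‖waveDeriv (yosida ε J) f k t - waveDeriv (yosida δ K) f k t‖ ≤ C * √(ε + δ)
  | k + 1, T => by
    obtain ⟨C, hC, h⟩ := waveDeriv_succ_cauchy hP hf k T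
    refine ⟨√C, Real.sqrt_nonneg _, fun ε hε J hJ δ hδ K hK t ht => ?_⟩
    rw [← Real.sqrt_mul hC]
    exact h ε hε J hJ δ hδ K hK t ht
  -- The energy controls no undifferentiated term, so the case k = 0 is integrated from the first
  -- derivative.
  | 0, T => by
    obtain ⟨C, hC, h⟩ := waveDeriv_succ_cauchy hP hf 0 T
    refine ⟨√C * |T|, by positivity, fun ε hε J hJ δ hδ K hK t ht => ?_⟩
    rcases le_total t 0 with h0 | h0
    · rw [waveDeriv_of_nonpos _ hf _ t h0, waveDeriv_of_nonpos _ hf _ t h0]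
      simpa using by positivity
    have h1 := norm_image_sub_le_of_norm_deriv_le_segment'
      (f := fun t => waveDeriv (yosida ε J) f 0 t - waveDeriv (yosida δ K) f 0 t)
      (a := 0) (b := T) (C := √C * √(ε + δ))
      (fun s _ => ((waveDeriv_hasDerivAt _ hf 0 s).sub
        (waveDeriv_hasDerivAt _ hf 0 s)).hasDerivWithinAt)
      (fun s hs => by
        rw [← Real.sqrt_mul hC]
        exact h ε hε J hJ δ hδ K hK s hs.2.le) t ⟨h0, ht⟩
    simp only [waveDeriv_of_nonpos _ hf _ 0 le_rfl, sub_zero] at h1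
    refine h1.trans ?_
    rw [mul_right_comm, abs_of_nonneg (h0.trans ht)]
    gcongr

/-- Existence for the abstract wave equation, together with the convergence of the Yosida
approximations. -/
theorem exists_wave (hP : IsNonnegSelfAdjoint P) {f : ℕ → ℝ → H} (hf : IsSource f)
    {ε : ℕ → ℝ} (hε : ∀ n, 0 < ε n) (hε0 : Tendsto ε atTop (𝓝 0)) {J : ℕ → H →L[ℝ] H}
    (hJ : ∀ n, IsResolvent P (ε n) (J n)) :
    ∃ X : ℕ → ℝ → H, (∀ k t, HasDerivAt (X k) (X (k + 1) t) t) ∧ (∀ k, X k 0 = 0) ∧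
      (∀ k t, (X k t, f k t - X (k + 2) t) ∈ P) ∧
      ∀ t, Tendsto (fun n => (boundedWave (yosida (ε n) (J n)) (f 0) t).1) atTop (𝓝 (X 0 t)) := by
  set x : ℕ → ℕ → ℝ → H := fun k n t => waveDeriv (yosida (ε n) (J n)) f k t with hxdef
  have hcau : ∀ k T, UniformCauchySeqOn (x k) atTop (Iic T) := by
    intro k T
    obtain ⟨C, hC, h⟩ := waveDeriv_cauchy hP hf k T
    rw [Metric.uniformCauchySeqOn_iff]
    intro η hη
    have h1 : Tendsto (fun p : ℕ × ℕ => C * √(ε p.1 + ε p.2)) (atTop ×ˢ atTop) (𝓝 0) := by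
      have h2 := (hε0.comp tendsto_fst).add (hε0.comp (tendsto_snd (f := (atTop : Filter ℕ))))
      simpa using (h2.sqrt).const_mul C
    rw [prod_atTop_atTop_eq] at h1
    obtain ⟨N, hN⟩ := eventually_atTop.1 (h1.eventually (gt_mem_nhds hη))
    refine ⟨max N.1 N.2, fun m hm n hn t ht => ?_⟩
    rw [dist_eq_norm]
    exact (h _ (hε m) _ (hJ m) _ (hε n) _ (hJ n) t ht).trans_lt
      (hN (m, n) ⟨(le_max_left _ _).trans hm, (le_max_right _ _).trans hn⟩)
  have hlim : ∀ k t, ∃ y, Tendsto (fun n => x k n t) atTop (𝓝 y) := fun k t =>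
    cauchySeq_tendsto_of_complete ((hcau k t).cauchySeq self_mem_Iic)
  choose X hX using hlim
  have hunif : ∀ k T, TendstoUniformlyOn (x k) (X k) atTop (Iic T) := fun k T =>
    (hcau k T).tendstoUniformlyOn_of_tendsto fun t _ => hX k t
  refine ⟨X, fun k t => ?_, fun k => ?_, fun k t => ?_, hX 0⟩
  · exact hasDerivAt_of_tendstoUniformlyOn (s := Iio (t + 1)) isOpen_Iio
      ((hunif (k + 1) (t + 1)).mono Iio_subset_Iic_self)
      (Eventually.of_forall fun n s _ => waveDeriv_hasDerivAt _ hf k s)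
      (fun s _ => hX k s) (by simp)
  · refine tendsto_nhds_unique (hX k 0) ?_
    simp only [hxdef, waveDeriv_of_nonpos _ hf k 0 le_rfl]
    exact tendsto_const_nhds
  -- By the equation, Bx converges, so Jx = x - εBx has the same limit as x. The pairs (Jx, Bx) lie
  -- in the closed set P, hence so does their limit.
  · have hB : Tendsto (fun n => yosida (ε n) (J n) (x k n t)) atTop (𝓝 (f k t - X (k + 2) t)) := by
      have h1 : ∀ n, yosida (ε n) (J n) (x k n t) = f k t - x (k + 2) n t := fun n => by
        simp [hxdef, waveDeriv_add_two]
      simp only [h1]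
      exact tendsto_const_nhds.sub (hX (k + 2) t)
    have hJx : Tendsto (fun n => J n (x k n t)) atTop (𝓝 (X k t)) := by
      have h1 : ∀ n, J n (x k n t) = x k n t - ε n • yosida (ε n) (J n) (x k n t) := fun n => by
        rw [eq_sub_iff_add_eq, IsResolvent.add_smul_yosida (hε n)]
      simp only [h1]
      simpa using (hX k t).sub (hε0.smul hB)
    exact hP.closed.mem_of_tendsto (hJx.prodMk_nhds hB)
      (Eventually.of_forall fun n => hJ n (x k n t))

end Abstract
-- Heat orbits, their Laplace transform, and the passage from heat to wave.
lemma intervalIntegral_mem_of_isClosed {E : Type*} [NormedAddCommGroup E] [NormedSpace ℝ E]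
    [CompleteSpace E] {P : Submodule ℝ E} (hP : IsClosed (P : Set E)) {φ : ℝ → E} {a b : ℝ}
    (hab : a ≤ b) (hφ : ContinuousOn φ (Icc a b)) (hm : ∀ s ∈ Icc a b, φ s ∈ P) :
    ∫ s in a..b, φ s ∈ P := by
  -- Closedness makes the quotient by P a normed space. The projection commutes with the integral
  -- and annihilates the integrand.
  have : IsClosed (P : Set E) := hP
  have h1 := P.mkQL.intervalIntegral_comp_comm (hφ.intervalIntegrable_of_Icc (μ := volume) hab)
  have h2 : ∫ s in a..b, P.mkQL (φ s) = 0 := by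
    rw [intervalIntegral.integral_congr (g := fun _ => 0), intervalIntegral.integral_zero]
    intro s hs
    rw [uIcc_of_le hab] at hs
    simpa using hm s hs
  rw [h2, Submodule.mkQL_apply] at h1
  exact (Submodule.Quotient.mk_eq_zero P).1 h1.symm

section Abstract

variable {H : Type*} [NormedAddCommGroup H] [InnerProductSpace ℝ H]

/-- `u` solves `u' + P u = 0` on `(0, ∞)`, with `p = P u`. -/
structure IsOrbit (P : Submodule ℝ (H × H)) (u p : ℝ → H) : Prop where
  continuousOn : ContinuousOn u (Ici 0)
  continuousOn' : ContinuousOn p (Ioi 0)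
  mem : ∀ t > 0, (u t, p t) ∈ P
  hasDerivAt : ∀ t > 0, HasDerivAt u (-p t) t

variable {P : Submodule ℝ (H × H)} {u p : ℝ → H}

lemma IsOrbit.norm_le (hu : IsOrbit P u p) (hn : ∀ p ∈ P, (0 : ℝ) ≤ inner ℝ p.2 p.1) {t : ℝ}
    (ht : 0 ≤ t) : ‖u t‖ ≤ ‖u 0‖ := by
  have hd : ∀ s > 0, HasDerivAt (fun s => inner ℝ (u s) (u s)) (2 * inner ℝ (u s) (-p s)) s := by
    intro s hs
    refine ((hu.hasDerivAt s hs).inner ℝ (hu.hasDerivAt s hs)).congr_deriv ?_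
    rw [real_inner_comm (u s) (-p s)]
    ring
  have hanti : AntitoneOn (fun s => (inner ℝ (u s) (u s) : ℝ)) (Ici 0) := by
    refine antitoneOn_of_deriv_nonpos (convex_Ici 0)
      (hu.continuousOn.inner hu.continuousOn) (fun s hs => ?_) fun s hs => ?_
    · rw [interior_Ici] at hs
      exact (hd s hs).differentiableAt.differentiableWithinAt
    · rw [interior_Ici] at hs
      rw [(hd s hs).deriv, inner_neg_right, real_inner_comm]
      have := hn _ (hu.mem s hs)
      simp only at this
      linarith
  have h := hanti self_mem_Ici ht ht
  simp only [real_inner_self_eq_norm_sq] at h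
  exact le_of_sq_le_sq h (norm_nonneg _)

lemma IsOrbit.shift (hu : IsOrbit P u p) {t : ℝ} (ht : 0 ≤ t) :
    IsOrbit P (fun s => u (t + s)) (fun s => p (t + s)) where
  continuousOn := hu.continuousOn.comp (by fun_prop) fun s hs => add_nonneg ht hs
  continuousOn' := hu.continuousOn'.comp (by fun_prop) fun s hs => add_pos_of_nonneg_of_pos ht hs
  mem s hs := hu.mem _ (add_pos_of_nonneg_of_pos ht hs)
  hasDerivAt s hs := (hu.hasDerivAt _ (add_pos_of_nonneg_of_pos ht hs)).comp_const_add t s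

lemma IsOrbit.integrableOn (hu : IsOrbit P u p) (hn : ∀ p ∈ P, (0 : ℝ) ≤ inner ℝ p.2 p.1) {ε : ℝ}
    (hε : 0 < ε) : IntegrableOn (fun s => Real.exp (-s) • u (ε * s)) (Ioi 0) := by
  have h1 : IntegrableOn (fun s => Real.exp (-s) * ‖u 0‖) (Ioi 0) :=
    (integrableOn_exp_neg_Ioi 0).mul_const _
  refine h1.mono' ?_ ?_
  · refine ContinuousOn.aestronglyMeasurable ?_ measurableSet_Ioi
    refine ContinuousOn.smul (by fun_prop) (hu.continuousOn.comp (by fun_prop) fun s hs => ?_)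
    exact mul_nonneg hε.le (le_of_lt hs)
  · filter_upwards [ae_restrict_mem measurableSet_Ioi] with s hs
    rw [norm_smul, Real.norm_of_nonneg (Real.exp_nonneg _)]
    exact mul_le_mul_of_nonneg_left (hu.norm_le hn (mul_nonneg hε.le (le_of_lt hs)))
      (Real.exp_nonneg _)

variable [CompleteSpace H]

/-- Integrating the pair e^{-s}(u(εs), Pu(εs)) stays in P, and integration by parts turns the second
component into boundary terms and the integral of u. The lower limit a is positive because Pu is
controlled only on (0, ∞). -/
lemma IsOrbit.truncated_mem (hu : IsOrbit P u p) (hc : IsClosed (P : Set (H × H))) {ε : ℝ}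
    (hε : 0 < ε) {a b : ℝ} (ha : 0 < a) (hab : a ≤ b) :
    (∫ s in a..b, Real.exp (-s) • u (ε * s), ε⁻¹ • (Real.exp (-a) • u (ε * a)
      - Real.exp (-b) • u (ε * b) - ∫ s in a..b, Real.exp (-s) • u (ε * s))) ∈ P := by
  have hpos : ∀ s ∈ Icc a b, 0 < ε * s := fun s hs => mul_pos hε (ha.trans_le hs.1)
  have hcu : ContinuousOn (fun s => Real.exp (-s) • u (ε * s)) (Icc a b) :=
    ContinuousOn.smul (by fun_prop)
      (hu.continuousOn.comp (by fun_prop) fun s hs => (hpos s hs).le)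
  have hcp : ContinuousOn (fun s => Real.exp (-s) • p (ε * s)) (Icc a b) :=
    ContinuousOn.smul (by fun_prop) (hu.continuousOn'.comp (by fun_prop) fun s hs => hpos s hs)
  have hIu := hcu.intervalIntegrable_of_Icc (μ := volume) hab
  have hIp := hcp.intervalIntegrable_of_Icc (μ := volume) hab
  have h1 := intervalIntegral_mem_of_isClosed hc hab (hcu.prodMk hcp) fun s hs =>
    P.smul_mem (Real.exp (-s)) (hu.mem _ (hpos s hs))
  have h2 := (ContinuousLinearMap.fst ℝ H H).intervalIntegral_comp_comm
    ((hcu.prodMk hcp).intervalIntegrable_of_Icc (μ := volume) hab)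
  have h3 := (ContinuousLinearMap.snd ℝ H H).intervalIntegral_comp_comm
    ((hcu.prodMk hcp).intervalIntegrable_of_Icc (μ := volume) hab)
  simp only [ContinuousLinearMap.coe_fst', ContinuousLinearMap.coe_snd'] at h2 h3
  have h4 := intervalIntegral.integral_eq_sub_of_hasDerivAt (a := a) (b := b)
    (f := fun s => Real.exp (-s) • u (ε * s))
    (f' := fun s => -(Real.exp (-s) • u (ε * s)) - ε • (Real.exp (-s) • p (ε * s)))
    (fun s hs => by
      rw [uIcc_of_le hab] at hs
      have e1 : HasDerivAt (fun s : ℝ => Real.exp (-s)) (-Real.exp (-s)) s := by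
        simpa using (hasDerivAt_neg s).exp
      have e2 : HasDerivAt (fun s => u (ε * s)) (ε • (-p (ε * s))) s := by
        have e3 : HasDerivAt (fun s : ℝ => ε * s) ε s := by
          simpa using (hasDerivAt_id s).const_mul ε
        exact (hu.hasDerivAt _ (hpos s hs)).scomp s e3
      refine (e1.smul e2).congr_deriv ?_
      simp only [smul_neg, neg_smul, smul_comm ε]
      abel) ((hIu.neg).sub (hIp.smul ε))
  have h5 := intervalIntegral.integral_sub hIu.neg (hIp.smul ε)
  simp only [Pi.neg_apply, Pi.smul_apply] at h5
  rw [h5, intervalIntegral.integral_neg,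
    intervalIntegral.integral_smul] at h4
  convert h1 using 1
  refine Prod.ext h2 ?_
  rw [← h3]
  simp only
  rw [inv_smul_eq_iff₀ hε.ne']
  rw [← sub_eq_zero] at h4 ⊢
  rw [← h4]
  abel

/-- The truncated identity involves only u, which is bounded and continuous up to 0. Closedness of P
thus allows a → 0 and b → ∞ without any integrability of Pu. -/
lemma IsOrbit.resolvent_mem (hu : IsOrbit P u p) (hc : IsClosed (P : Set (H × H)))
    (hn : ∀ p ∈ P, (0 : ℝ) ≤ inner ℝ p.2 p.1) {ε : ℝ} (hε : 0 < ε) :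
    (∫ s in Ioi 0, Real.exp (-s) • u (ε * s),
      ε⁻¹ • (u 0 - ∫ s in Ioi 0, Real.exp (-s) • u (ε * s))) ∈ P := by
  set φ : ℝ → H := fun s => Real.exp (-s) • u (ε * s) with hφ
  have hint := hu.integrableOn hn hε
  have hcont : ContinuousOn φ (Ici 0) := ContinuousOn.smul (by fun_prop)
    (hu.continuousOn.comp (by fun_prop) fun s hs => mul_nonneg hε.le hs)
  have hφn : ∀ s ≥ 0, ‖φ s‖ ≤ Real.exp (-s) * ‖u 0‖ := fun s hs => by
    rw [hφ, norm_smul, Real.norm_of_nonneg (Real.exp_nonneg _)]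
    exact mul_le_mul_of_nonneg_left (hu.norm_le hn (mul_nonneg hε.le hs)) (Real.exp_nonneg _)
  have step1 : ∀ b > 0, (∫ s in (0 : ℝ)..b, φ s, ε⁻¹ • (u 0 - φ b - ∫ s in (0 : ℝ)..b, φ s)) ∈ P := by
    intro b hb
    have hI : Tendsto (fun a => ∫ s in a..b, φ s) (𝓝[>] 0) (𝓝 (∫ s in (0 : ℝ)..b, φ s)) := by
      have h1 : Tendsto (fun a : ℝ => ∫ s in (0 : ℝ)..a, φ s) (𝓝[>] 0) (𝓝 0) := by
        refine squeeze_zero_norm' (a := fun a => ‖u 0‖ * |a - 0|) ?_ ?_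
        · filter_upwards [self_mem_nhdsWithin] with a ha
          refine intervalIntegral.norm_integral_le_of_norm_le_const fun s hs => ?_
          rw [uIoc_of_le (le_of_lt ha)] at hs
          refine (hφn s hs.1.le).trans ?_
          have : Real.exp (-s) ≤ 1 := Real.exp_le_one_iff.2 (by linarith [hs.1])
          nlinarith [norm_nonneg (u 0)]
        · refine Tendsto.mono_left ?_ nhdsWithin_le_nhds
          have : Continuous fun a : ℝ => ‖u 0‖ * |a - 0| := by fun_prop
          simpa using this.tendsto 0
      have h2 : Tendsto (fun a : ℝ => (∫ s in (0 : ℝ)..b, φ s) - ∫ s in (0 : ℝ)..a, φ s) (𝓝[>] 0)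
          (𝓝 (∫ s in (0 : ℝ)..b, φ s)) := by simpa using h1.const_sub (∫ s in (0 : ℝ)..b, φ s)
      refine h2.congr' ?_
      filter_upwards [self_mem_nhdsWithin] with a ha
      have hi : ∀ c ≥ (0 : ℝ), IntervalIntegrable φ volume 0 c := fun c hc =>
        (hcont.mono Icc_subset_Ici_self).intervalIntegrable_of_Icc hc
      exact intervalIntegral.integral_interval_sub_left (hi b hb.le) (hi a (le_of_lt ha))
    have hφ0 : Tendsto φ (𝓝[>] 0) (𝓝 (u 0)) := by
      have := (hcont 0 self_mem_Ici).mono_left (nhdsWithin_mono 0 Ioi_subset_Ici_self)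
      simpa [hφ] using this
    refine hc.mem_of_tendsto (hI.prodMk_nhds (((hφ0.sub_const (φ b)).sub hI).const_smul ε⁻¹)) ?_
    filter_upwards [Ioc_mem_nhdsGT hb] with a ha
    exact hu.truncated_mem hc hε ha.1 ha.2
  have hI : Tendsto (fun b => ∫ s in (0 : ℝ)..b, φ s) atTop (𝓝 (∫ s in Ioi 0, φ s)) :=
    intervalIntegral_tendsto_integral_Ioi 0 hint tendsto_id
  have hφi : Tendsto φ atTop (𝓝 0) := by
    refine squeeze_zero_norm' (a := fun b => Real.exp (-b) * ‖u 0‖) ?_ ?_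
    · filter_upwards [eventually_ge_atTop 0] with b hb using hφn b hb
    · simpa using (Real.tendsto_exp_neg_atTop_nhds_zero).mul_const ‖u 0‖
  have h1 := ((hφi.const_sub (u 0)).sub hI).const_smul ε⁻¹
  rw [sub_zero] at h1
  refine hc.mem_of_tendsto (hI.prodMk_nhds h1) ?_
  filter_upwards [eventually_gt_atTop 0] with b hb using step1 b hb

/-- The graph of a closed, symmetric, nonnegative operator which generates a heat flow is
self-adjoint. -/
lemma isNonnegSelfAdjoint_of_orbits (hc : IsClosed (P : Set (H × H)))
    (hs : ∀ p ∈ P, ∀ q ∈ P, inner ℝ p.2 q.1 = inner ℝ p.1 q.2)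
    (hn : ∀ p ∈ P, (0 : ℝ) ≤ inner ℝ p.2 p.1)
    (hu : ∀ x, ∃ u p, IsOrbit P u p ∧ u 0 = x) : IsNonnegSelfAdjoint P where
  closed := hc
  symm := hs
  nonneg := hn
  range ε hε x := by
    obtain ⟨u, p, hu, rfl⟩ := hu x
    exact ⟨_, hu.resolvent_mem hc hn hε⟩

lemma IsOrbit.apply_resolvent (hP : IsNonnegSelfAdjoint P) (hu : IsOrbit P u p) {ε : ℝ}
    (hε : 0 < ε) {J : H →L[ℝ] H} (hJ : IsResolvent P ε J) (L : H →L[ℝ] ℝ) {t : ℝ} (ht : 0 ≤ t) :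
    L (J (u t)) = ∫ s in Ioi 0, Real.exp (-s) * L (u (t + ε * s)) := by
  have h1 := (hu.shift ht).resolvent_mem hP.closed hP.nonneg hε
  simp only [add_zero] at h1
  rw [eq_of_resolvent hP hε (hJ (u t)) h1,
    ← L.integral_comp_comm ((hu.shift ht).integrableOn hP.nonneg hε)]
  simp

variable {H₁ H₂ : Type*} [NormedAddCommGroup H₁] [InnerProductSpace ℝ H₁] [CompleteSpace H₁]
  [NormedAddCommGroup H₂] [InnerProductSpace ℝ H₂] [CompleteSpace H₂]
  {P₁ : Submodule ℝ (H₁ × H₁)} {P₂ : Submodule ℝ (H₂ × H₂)}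
  {u₁ p₁ : ℝ → H₁} {u₂ p₂ : ℝ → H₂} {h₁ : H₁} {h₂ : H₂}

/-- J(u(t)) is an average of the later values u(t + εs), so the induction must run over all times at
once. -/
lemma resolvent_pow_pairing (hP₁ : IsNonnegSelfAdjoint P₁) (hP₂ : IsNonnegSelfAdjoint P₂)
    (hu₁ : IsOrbit P₁ u₁ p₁) (hu₂ : IsOrbit P₂ u₂ p₂) {ε : ℝ} (hε : 0 < ε)
    {J₁ : H₁ →L[ℝ] H₁} {J₂ : H₂ →L[ℝ] H₂} (hJ₁ : IsResolvent P₁ ε J₁) (hJ₂ : IsResolvent P₂ ε J₂)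
    (h : ∀ t ≥ 0, inner ℝ h₁ (u₁ t) = inner ℝ h₂ (u₂ t)) (m : ℕ) :
    ∀ t ≥ 0, inner ℝ h₁ ((J₁ ^ m) (u₁ t)) = inner ℝ h₂ ((J₂ ^ m) (u₂ t)) := by
  induction m with
  | zero => simpa using h
  | succ m ih =>
    intro t ht
    have e1 := hu₁.apply_resolvent hP₁ hε hJ₁ ((innerSL ℝ h₁).comp (J₁ ^ m)) ht
    have e2 := hu₂.apply_resolvent hP₂ hε hJ₂ ((innerSL ℝ h₂).comp (J₂ ^ m)) ht
    simp only [ContinuousLinearMap.comp_apply, innerSL_apply_apply] at e1 e2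
    rw [pow_succ, pow_succ, mul_apply_eq_comp, mul_apply_eq_comp, e1, e2]
    refine setIntegral_congr_fun measurableSet_Ioi fun s hs => ?_
    rw [ih _ (add_nonneg ht (mul_nonneg hε.le (le_of_lt hs)))]

lemma yosida_pow_pairing (hP₁ : IsNonnegSelfAdjoint P₁) (hP₂ : IsNonnegSelfAdjoint P₂)
    (hu₁ : IsOrbit P₁ u₁ p₁) (hu₂ : IsOrbit P₂ u₂ p₂) {ε : ℝ} (hε : 0 < ε)
    {J₁ : H₁ →L[ℝ] H₁} {J₂ : H₂ →L[ℝ] H₂} (hJ₁ : IsResolvent P₁ ε J₁) (hJ₂ : IsResolvent P₂ ε J₂)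
    (h : ∀ t ≥ 0, inner ℝ h₁ (u₁ t) = inner ℝ h₂ (u₂ t)) (m : ℕ) :
    inner ℝ h₁ ((yosida ε J₁ ^ m) (u₁ 0)) = inner ℝ h₂ ((yosida ε J₂ ^ m) (u₂ 0)) := by
  -- Mixed powers close the induction: Bᵐ⁺¹Jᵏ = ε⁻¹(BᵐJᵏ - BᵐJᵏ⁺¹).
  have key : ∀ m k : ℕ, inner ℝ h₁ ((yosida ε J₁ ^ m) ((J₁ ^ k) (u₁ 0)))
      = inner ℝ h₂ ((yosida ε J₂ ^ m) ((J₂ ^ k) (u₂ 0))) := by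
    intro m
    induction m with
    | zero =>
      intro k
      simpa using resolvent_pow_pairing hP₁ hP₂ hu₁ hu₂ hε hJ₁ hJ₂ h k 0 le_rfl
    | succ m ih =>
      intro k
      have h1 := ih k
      have h2 := ih (k + 1)
      simp only [pow_succ', mul_apply_eq_comp] at h2
      simp only [pow_succ (yosida _ _), mul_apply_eq_comp, yosida_apply, map_smul, map_sub,
        inner_smul_right, inner_sub_right, h1, h2]
  simpa using key m 0

/-- If the heat flows of two operators have the same pairings, so do the wave flows. -/
theorem exists_wave_pairing_eq (hP₁ : IsNonnegSelfAdjoint P₁) (hP₂ : IsNonnegSelfAdjoint P₂)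
    {f₁ : ℕ → ℝ → H₁} {f₂ : ℕ → ℝ → H₂} (hf₁ : IsSource f₁) (hf₂ : IsSource f₂) :
    ∃ (X₁ : ℕ → ℝ → H₁) (X₂ : ℕ → ℝ → H₂),
      ((∀ k t, HasDerivAt (X₁ k) (X₁ (k + 1) t) t) ∧ (∀ k, X₁ k 0 = 0) ∧
        ∀ k t, (X₁ k t, f₁ k t - X₁ (k + 2) t) ∈ P₁) ∧
      ((∀ k t, HasDerivAt (X₂ k) (X₂ (k + 1) t) t) ∧ (∀ k, X₂ k 0 = 0) ∧
        ∀ k t, (X₂ k t, f₂ k t - X₂ (k + 2) t) ∈ P₂) ∧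
      ∀ h₁ h₂, (∀ s, ∃ u₁ p₁ u₂ p₂, IsOrbit P₁ u₁ p₁ ∧ u₁ 0 = f₁ 0 s ∧
          IsOrbit P₂ u₂ p₂ ∧ u₂ 0 = f₂ 0 s ∧
          ∀ t ≥ 0, inner ℝ h₁ (u₁ t) = inner ℝ h₂ (u₂ t)) →
        ∀ t, inner ℝ h₁ (X₁ 0 t) = inner ℝ h₂ (X₂ 0 t) := by
  set ε : ℕ → ℝ := fun n => 1 / ((n : ℝ) + 1)
  have hε : ∀ n, 0 < ε n := fun n => Nat.one_div_pos_of_nat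
  have hε0 : Tendsto ε atTop (𝓝 0) := tendsto_one_div_add_atTop_nhds_zero_nat
  choose J₁ hJ₁ using fun n => exists_resolvent hP₁ (hε n)
  choose J₂ hJ₂ using fun n => exists_resolvent hP₂ (hε n)
  obtain ⟨X₁, hd₁, hz₁, hm₁, hl₁⟩ := exists_wave hP₁ hf₁ hε hε0 hJ₁
  obtain ⟨X₂, hd₂, hz₂, hm₂, hl₂⟩ := exists_wave hP₂ hf₂ hε hε0 hJ₂
  refine ⟨X₁, X₂, ⟨hd₁, hz₁, hm₁⟩, ⟨hd₂, hz₂, hm₂⟩, fun h₁ h₂ h t => ?_⟩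
  refine tendsto_nhds_unique ((tendsto_const_nhds (x := h₁)).inner (𝕜 := ℝ) (hl₁ t)) ?_
  refine ((tendsto_const_nhds (x := h₂)).inner (𝕜 := ℝ) (hl₂ t)).congr fun n => ?_
  refine (boundedWave_pairing_eq (hf₁.continuous 0) (hf₂.continuous 0) (fun m s => ?_) t).symm
  obtain ⟨u₁, p₁, u₂, p₂, hu₁, e₁, hu₂, e₂, hu⟩ := h s
  rw [← e₁, ← e₂]
  exact yosida_pow_pairing hP₁ hP₂ hu₁ hu₂ (hε n) (hJ₁ n) (hJ₂ n) hu m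

end Abstract
-- Operators of closed coercive forms.
section Form

variable {H K : Type*} [NormedAddCommGroup H] [InnerProductSpace ℝ H]
  [NormedAddCommGroup K] [InnerProductSpace ℝ K]

/-- The triples `(u, G, f)` such that `(u, G)` lies in the form domain `D` and `u` solves the
variational problem `⟪M G, ·⟫ + ⟪S u, ·⟫ = ⟪f, ·⟫` on `D`. -/
def formGraph (D : Submodule ℝ (H × K)) (M : K →L[ℝ] K) (S : H →L[ℝ] H) :
    Submodule ℝ (H × K × H) where
  carrier := {z | (z.1, z.2.1) ∈ D ∧
    ∀ q ∈ D, inner ℝ (M z.2.1) q.2 + inner ℝ (S z.1) q.1 = inner ℝ z.2.2 q.1}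
  zero_mem' := ⟨D.zero_mem, fun q _ => by simp⟩
  add_mem' := fun {a b} ha hb => ⟨D.add_mem ha.1 hb.1, fun q hq => by
    have h1 := ha.2 q hq
    have h2 := hb.2 q hq
    simp only [Prod.fst_add, Prod.snd_add, map_add, inner_add_left]
    linarith⟩
  smul_mem' := fun c a ha => ⟨D.smul_mem c ha.1, fun q hq => by
    simp only [Prod.smul_fst, Prod.smul_snd, map_smul, inner_smul_left, ← ha.2 q hq]
    ring⟩

/-- The graph of the operator associated with a quadratic form. -/
def formOperator (D : Submodule ℝ (H × K)) (M : K →L[ℝ] K) (S : H →L[ℝ] H) :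
    Submodule ℝ (H × H) :=
  (formGraph D M S).map (((ContinuousLinearMap.fst ℝ H (K × H)).prod
    ((ContinuousLinearMap.snd ℝ K H).comp (ContinuousLinearMap.snd ℝ H (K × H)))) :
      H × K × H →ₗ[ℝ] H × H)

variable {D : Submodule ℝ (H × K)} {M : K →L[ℝ] K} {S : H →L[ℝ] H}

lemma mem_formOperator {p : H × H} :
    p ∈ formOperator D M S ↔ ∃ G, (p.1, G, p.2) ∈ formGraph D M S := by
  constructor
  · rintro ⟨z, hz, rfl⟩
    exact ⟨z.2.1, hz⟩
  · rintro ⟨G, hG⟩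
    exact ⟨_, hG, rfl⟩

lemma isClosed_formGraph (hD : IsClosed (D : Set (H × K))) :
    IsClosed (formGraph D M S : Set (H × K × H)) := by
  have h1 : IsClosed {z : H × K × H | (z.1, z.2.1) ∈ D} := hD.preimage (by fun_prop)
  have h2 : IsClosed {z : H × K × H | ∀ q ∈ D,
      inner ℝ (M z.2.1) q.2 + inner ℝ (S z.1) q.1 = inner ℝ z.2.2 q.1} := by
    simp only [ofPred_forall]
    exact isClosed_iInter fun q => isClosed_iInter fun _ => isClosed_eq
      (by fun_prop) (by fun_prop)
  exact h1.inter h2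

lemma formGraph_coercive {c : ℝ} (hM : ∀ G, c * ‖G‖ ^ 2 ≤ inner ℝ (M G) G)
    (hS : ∀ u, 0 ≤ inner ℝ (S u) u) {z : H × K × H} (hz : z ∈ formGraph D M S) :
    c * ‖z.2.1‖ ^ 2 ≤ inner ℝ z.2.2 z.1 := by
  have h1 := hz.2 _ hz.1
  simp only at h1
  linarith [hM z.2.1, hS z.1]

lemma formOperator_nonneg {c : ℝ} (hc : 0 < c) (hM : ∀ G, c * ‖G‖ ^ 2 ≤ inner ℝ (M G) G)
    (hS : ∀ u, 0 ≤ inner ℝ (S u) u) : ∀ p ∈ formOperator D M S, (0 : ℝ) ≤ inner ℝ p.2 p.1 := by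
  intro p hp
  obtain ⟨G, hG⟩ := mem_formOperator.1 hp
  exact le_trans (by positivity) (formGraph_coercive hM hS hG)

lemma formOperator_symm (hM : ∀ G G', inner ℝ (M G) G' = inner ℝ G (M G'))
    (hS : ∀ u v, inner ℝ (S u) v = inner ℝ u (S v)) :
    ∀ p ∈ formOperator D M S, ∀ q ∈ formOperator D M S,
      inner ℝ p.2 q.1 = inner ℝ p.1 q.2 := by
  intro p hp q hq
  obtain ⟨G, hG⟩ := mem_formOperator.1 hp
  obtain ⟨G', hG'⟩ := mem_formOperator.1 hq
  have h1 := hG.2 _ hG'.1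
  have h2 := hG'.2 _ hG.1
  simp only at h1 h2
  rw [← h1, real_inner_comm q.2 p.1, ← h2, hM, hS, real_inner_comm G (M G'),
    real_inner_comm p.1 (S q.1)]

/-- The graph is the projection of the closed space of triples (u, G, f). Coercivity c‖G‖² ≤ ⟨f, u⟩
bounds G by √c⁻¹ times the norm of (u, f), so this projection is antilipschitz and its range is
closed. -/
lemma isClosed_formOperator [CompleteSpace H] [CompleteSpace K] {c : ℝ} (hc : 0 < c)
    (hD : IsClosed (D : Set (H × K))) (hM : ∀ G, c * ‖G‖ ^ 2 ≤ inner ℝ (M G) G)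
    (hS : ∀ u, 0 ≤ inner ℝ (S u) u) : IsClosed (formOperator D M S : Set (H × H)) := by
  have hQ : IsClosed (formGraph D M S : Set (H × K × H)) := isClosed_formGraph hD
  have : CompleteSpace (formGraph D M S) := hQ.completeSpace_coe
  let π : formGraph D M S →L[ℝ] H × H := ((ContinuousLinearMap.fst ℝ H (K × H)).prod
    ((ContinuousLinearMap.snd ℝ K H).comp (ContinuousLinearMap.snd ℝ H (K × H)))).comp
      (formGraph D M S).subtypeL
  have hrange : (formOperator D M S : Set (H × H)) = range π := by
    ext p
    constructor
    · rintro ⟨z, hz, rfl⟩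
      exact ⟨⟨z, hz⟩, rfl⟩
    · rintro ⟨z, rfl⟩
      exact ⟨z, z.2, rfl⟩
  rw [hrange]
  have hanti : AntilipschitzWith (Real.toNNReal (1 + √c⁻¹)) π := by
    refine AddMonoidHomClass.antilipschitz_of_bound π fun z => ?_
    rw [Real.coe_toNNReal _ (by positivity)]
    have hz1 : ‖(z : H × K × H).1‖ ≤ ‖π z‖ := norm_fst_le (π z)
    have hz2 : ‖(z : H × K × H).2.2‖ ≤ ‖π z‖ := norm_snd_le (π z)
    have h1 := formGraph_coercive hM hS z.2
    have h2 := real_inner_le_norm (z : H × K × H).2.2 (z : H × K × H).1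
    have h3 : ‖(z : H × K × H).2.1‖ ≤ √c⁻¹ * ‖π z‖ := by
      rw [← Real.sqrt_sq (norm_nonneg (π z)), ← Real.sqrt_mul (by positivity)]
      refine Real.le_sqrt_of_sq_le ?_
      rw [← div_eq_inv_mul, le_div_iff₀ hc]
      have h4 := mul_le_mul hz2 hz1 (norm_nonneg _) (norm_nonneg _)
      nlinarith
    have h5 : 0 ≤ √c⁻¹ * ‖π z‖ := by positivity
    have h6 := norm_nonneg (π z)
    change ‖(z : H × K × H)‖ ≤ _
    refine max_le ?_ (max_le ?_ ?_) <;> linarith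
  exact hanti.isClosed_range π.uniformContinuous

/-- Coercivity applied to the difference of two triples gives c‖G(s) - G(t)‖² ≤ ⟨f(s) - f(t), w(s) -
w(t)⟩. -/
lemma continuous_gradient_of_mem_formGraph {c : ℝ} (hc : 0 < c)
    (hM : ∀ G, c * ‖G‖ ^ 2 ≤ inner ℝ (M G) G) (hS : ∀ u, 0 ≤ inner ℝ (S u) u)
    {w f : ℝ → H} {G : ℝ → K} (hw : Continuous w) (hf : Continuous f)
    (h : ∀ t, (w t, G t, f t) ∈ formGraph D M S) : Continuous G := by
  rw [continuous_iff_continuousAt]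
  intro t
  rw [ContinuousAt, tendsto_iff_norm_sub_tendsto_zero]
  have h1 : Tendsto (fun s => √(c⁻¹ * inner ℝ (f s - f t) (w s - w t))) (𝓝 t) (𝓝 0) := by
    have : Continuous fun s => √(c⁻¹ * inner ℝ (f s - f t) (w s - w t)) := by fun_prop
    simpa using this.tendsto t
  refine squeeze_zero (fun _ => norm_nonneg _) (fun s => ?_) h1
  refine Real.le_sqrt_of_sq_le ?_
  rw [← div_eq_inv_mul, le_div_iff₀ hc, mul_comm]
  exact formGraph_coercive hM hS ((formGraph D M S).sub_mem (h s) (h t))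

end Form

/-! ### Multiplication operators on L² and inverse matrices. -/

section Multiplication

variable {X E F : Type*} [MeasurableSpace X] [NormedAddCommGroup E] [NormedSpace ℝ E]
  [NormedAddCommGroup F] [NormedSpace ℝ F] {μ : Measure X}

lemma exists_multiplication_operator {T : X → E →L[ℝ] F} (hT : AEStronglyMeasurable T μ) {C : ℝ}
    (hC : ∀ᵐ x ∂μ, ‖T x‖ ≤ C) :
    ∃ M : Lp E 2 μ →L[ℝ] Lp F 2 μ, ∀ G : Lp E 2 μ, M G =ᵐ[μ] fun x => T x (G x) := by
  have hle : ∀ G : Lp E 2 μ, ∀ᵐ x ∂μ, ‖T x (G x)‖ ≤ C * ‖G x‖ := fun G => by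
    filter_upwards [hC] with x hx
    exact (T x).le_of_opNorm_le hx _
  have hmem : ∀ G : Lp E 2 μ, MemLp (fun x => T x (G x)) 2 μ := fun G =>
    (Lp.memLp G).of_le_mul (isBoundedBilinearMap_apply.continuous.comp_aestronglyMeasurable
      (hT.prodMk (Lp.aestronglyMeasurable G))) (hle G)
  refine ⟨LinearMap.mkContinuous
    { toFun := fun G => (hmem G).toLp _
      map_add' := fun G G' => ?_
      map_smul' := fun c G => ?_ } C fun G => ?_, fun G => (hmem G).coeFn_toLp⟩
  · rw [← MemLp.toLp_add]
    refine MemLp.toLp_congr _ _ ?_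
    filter_upwards [Lp.coeFn_add G G'] with x hx
    rw [hx]
    exact map_add (T x) _ _
  · rw [RingHom.id_apply, ← MemLp.toLp_const_smul]
    refine MemLp.toLp_congr _ _ ?_
    filter_upwards [Lp.coeFn_smul c G] with x hx
    rw [hx]
    exact map_smul (T x) _ _
  · refine Lp.norm_le_mul_norm_of_ae_le_mul ?_
    filter_upwards [hle G, (hmem G).coeFn_toLp] with x h1 h2
    simpa [h2] using h1

end Multiplication

section MatrixInverse

variable {n : ℕ}

/-- Completing the square: with η = A⁻¹ξ, 0 ≤ (cξ - η)·A(cξ - η) = c² ξ·Aξ - 2c|ξ|² + ξ·η. The upper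
bound on A makes the first term at most c|ξ|². -/
lemma inv_coercive {A : Matrix (Fin n) (Fin n) ℝ} (hA : A.IsSymm) {c : ℝ} (hc : 0 < c)
    (h : ∀ ξ : Fin n → ℝ, c * (ξ ⬝ᵥ ξ) ≤ ξ ⬝ᵥ A.mulVec ξ ∧ ξ ⬝ᵥ A.mulVec ξ ≤ c⁻¹ * (ξ ⬝ᵥ ξ))
    (hdet : A.det ≠ 0) (ξ : Fin n → ℝ) : c * (ξ ⬝ᵥ ξ) ≤ ξ ⬝ᵥ A⁻¹.mulVec ξ := by
  set η := A⁻¹.mulVec ξ with hη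
  have hAη : A.mulVec η = ξ := by
    rw [hη, Matrix.mulVec_mulVec, Matrix.mul_nonsing_inv _ (isUnit_iff_ne_zero.2 hdet),
      Matrix.one_mulVec]
  have h1 := (h (c • ξ - η)).1
  have h2 := (h ξ).2
  have h0 : 0 ≤ (c • ξ - η) ⬝ᵥ (c • ξ - η) :=
    Finset.sum_nonneg fun i _ => mul_self_nonneg _
  have h3 : η ⬝ᵥ A.mulVec ξ = ξ ⬝ᵥ ξ := by
    rw [Matrix.dotProduct_mulVec, ← Matrix.mulVec_transpose, hA.eq, hAη]
  have h4 : (c • ξ - η) ⬝ᵥ A.mulVec (c • ξ - η)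
      = c ^ 2 * (ξ ⬝ᵥ A.mulVec ξ) - 2 * c * (ξ ⬝ᵥ ξ) + ξ ⬝ᵥ η := by
    simp only [Matrix.mulVec_sub, Matrix.mulVec_smul, sub_dotProduct, dotProduct_sub,
      smul_dotProduct, dotProduct_smul, hAη, h3, smul_eq_mul]
    rw [dotProduct_comm η ξ]
    ring
  have h5 : c ^ 2 * (ξ ⬝ᵥ A.mulVec ξ) ≤ c * (ξ ⬝ᵥ ξ) := by
    calc _ ≤ c ^ 2 * (c⁻¹ * (ξ ⬝ᵥ ξ)) := by gcongr
      _ = _ := by field_simp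
  nlinarith [mul_nonneg hc.le h0]

lemma det_pos_of_elliptic {A : Matrix (Fin n) (Fin n) ℝ} (hA : A.IsSymm) {c : ℝ} (hc : 0 < c)
    (h : ∀ ξ : Fin n → ℝ, c * (ξ ⬝ᵥ ξ) ≤ ξ ⬝ᵥ A.mulVec ξ) : 0 < A.det := by
  refine Matrix.PosDef.det_pos (Matrix.PosDef.of_dotProduct_mulVec_pos ?_ fun {ξ} hξ => ?_)
  · rw [Matrix.IsHermitian, Matrix.conjTranspose_eq_transpose_of_trivial]
    exact hA
  · refine lt_of_lt_of_le (mul_pos hc ?_) (h ξ)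
    exact lt_of_le_of_ne (Finset.sum_nonneg fun i _ => mul_self_nonneg _)
      fun h => hξ (dotProduct_self_eq_zero.1 h.symm)

end MatrixInverse
variable {n : ℕ} {Ω : Set (Sp n)} {g : Sp n → Matrix (Fin n) (Fin n) ℝ} {V : Sp n → ℝ}

/-! ### The metric, its volume, test functions and the Dirichlet form. -/

section Metric

lemma IsEllipticMetric.continuousOn (hg : IsEllipticMetric Ω g) : ContinuousOn g (closure Ω) :=
  continuousOn_pi.2 fun i => continuousOn_pi.2 fun j => (hg.smooth i j).continuousOn

lemma IsEllipticMetric.continuousOn_det (hg : IsEllipticMetric Ω g) :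
    ContinuousOn (fun x => (g x).det) (closure Ω) :=
  (Continuous.matrix_det continuous_id).comp_continuousOn hg.continuousOn

/-- Ellipticity extends by continuity to the compact closure, where continuity then bounds the
inverse metric and the reciprocal of the volume density. -/
lemma IsEllipticMetric.exists_elliptic_closure (hg : IsEllipticMetric Ω g) :
    ∃ c : ℝ, 0 < c ∧ ∀ x ∈ closure Ω, ∀ ξ : Fin n → ℝ,
      c * (ξ ⬝ᵥ ξ) ≤ ξ ⬝ᵥ (g x).mulVec ξ ∧ ξ ⬝ᵥ (g x).mulVec ξ ≤ c⁻¹ * (ξ ⬝ᵥ ξ) := by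
  obtain ⟨c, hc, -, h⟩ := hg.elliptic
  refine ⟨c, hc, fun x hx ξ => ?_⟩
  have hcont : ContinuousOn (fun y => ξ ⬝ᵥ (g y).mulVec ξ) (closure Ω) := by
    have h1 : Continuous fun A : Matrix (Fin n) (Fin n) ℝ => ξ ⬝ᵥ A.mulVec ξ :=
      Continuous.dotProduct continuous_const (Continuous.matrix_mulVec continuous_id continuous_const)
    exact h1.comp_continuousOn hg.continuousOn
  have hc1 := (hcont x hx).mono subset_closure
  exact ⟨continuousWithinAt_const.closure_le hx hc1 fun y hy => (h y hy ξ).1,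
    hc1.closure_le hx continuousWithinAt_const fun y hy => (h y hy ξ).2⟩

lemma IsEllipticMetric.det_pos (hg : IsEllipticMetric Ω g) {x : Sp n} (hx : x ∈ closure Ω) :
    0 < (g x).det := by
  obtain ⟨c, hc, h⟩ := hg.exists_elliptic_closure
  exact det_pos_of_elliptic (hg.symm x hx) hc fun ξ => (h x hx ξ).1

lemma IsEllipticMetric.continuousOn_inv (hg : IsEllipticMetric Ω g) :
    ContinuousOn (fun x => (g x)⁻¹) (closure Ω) := by
  have h1 : ContinuousOn (fun x => ((g x).det)⁻¹ • (g x).adjugate) (closure Ω) :=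
    (hg.continuousOn_det.inv₀ fun x hx => (hg.det_pos hx).ne').smul
      ((Continuous.matrix_adjugate continuous_id).comp_continuousOn hg.continuousOn)
  refine h1.congr fun x _ => ?_
  simp only [Matrix.inv_def, Ring.inverse_eq_inv']

/-- The inverse metric as a field of operators. -/
def coMetric (g : Sp n → Matrix (Fin n) (Fin n) ℝ) (x : Sp n) : Sp n →L[ℝ] Sp n :=
  Matrix.toEuclideanCLM (n := Fin n) (𝕜 := ℝ) (g x)⁻¹

lemma inner_coMetric (x ξ η : Sp n) :
    inner ℝ ξ (coMetric g x η) = ∑ i, ∑ j, (g x)⁻¹ i j * ξ i * η j := by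
  rw [coMetric, Matrix.inner_toEuclideanCLM]
  simp only [dotProduct, Matrix.mulVec, Finset.mul_sum]
  refine Finset.sum_congr rfl fun i _ => Finset.sum_congr rfl fun j _ => ?_
  ring

lemma IsEllipticMetric.coMetric_symm (hg : IsEllipticMetric Ω g) {x : Sp n} (hx : x ∈ closure Ω)
    (ξ η : Sp n) : inner ℝ (coMetric g x ξ) η = inner ℝ ξ (coMetric g x η) := by
  rw [real_inner_comm, inner_coMetric, inner_coMetric, Finset.sum_comm]
  refine Finset.sum_congr rfl fun i _ => Finset.sum_congr rfl fun j _ => ?_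
  have h1 : ((g x)⁻¹).IsSymm := by
    rw [Matrix.IsSymm, Matrix.transpose_nonsing_inv, (hg.symm x hx).eq]
  rw [← h1.apply i j]
  ring

lemma IsEllipticMetric.continuousOn_coMetric (hg : IsEllipticMetric Ω g) :
    ContinuousOn (coMetric g) (closure Ω) := by
  have h1 : Continuous fun A : Matrix (Fin n) (Fin n) ℝ =>
      Matrix.toEuclideanCLM (n := Fin n) (𝕜 := ℝ) A :=
    LinearMap.continuous_of_finiteDimensional
      ((Matrix.toEuclideanCLM (n := Fin n) (𝕜 := ℝ)).toAlgEquiv.toLinearMap)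
  exact h1.comp_continuousOn hg.continuousOn_inv

lemma IsEllipticMetric.exists_coMetric_coercive (hg : IsEllipticMetric Ω g) :
    ∃ c : ℝ, 0 < c ∧ ∀ x ∈ closure Ω, ∀ ξ : Sp n,
      c * ‖ξ‖ ^ 2 ≤ inner ℝ (coMetric g x ξ) ξ := by
  obtain ⟨c, hc, h⟩ := hg.exists_elliptic_closure
  refine ⟨c, hc, fun x hx ξ => ?_⟩
  have h1 := inv_coercive (hg.symm x hx) hc (h x hx) (hg.det_pos hx).ne' ξ
  rw [real_inner_comm, coMetric, Matrix.inner_toEuclideanCLM]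
  refine le_trans (le_of_eq ?_) h1
  rw [EuclideanSpace.real_norm_sq_eq]
  simp only [dotProduct, sq]

end Metric

section Measure

lemma vol_absolutelyContinuous : vol Ω g ≪ volume.restrict Ω := withDensity_absolutelyContinuous _ _

lemma ae_mem_vol (hΩ : IsOpen Ω) : ∀ᵐ x ∂(vol Ω g), x ∈ Ω :=
  vol_absolutelyContinuous.ae_le (ae_restrict_mem hΩ.measurableSet)

lemma aestronglyMeasurable_vol {E : Type*} [NormedAddCommGroup E] (hΩ : IsOpen Ω)
    [SecondCountableTopologyEither (Sp n) E] {T : Sp n → E} (hT : ContinuousOn T (closure Ω)) :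
    AEStronglyMeasurable T (vol Ω g) :=
  ((hT.mono subset_closure).aestronglyMeasurable hΩ.measurableSet).mono_ac vol_absolutelyContinuous

lemma exists_ae_bound_vol {E : Type*} [NormedAddCommGroup E] (hΩ : IsOpen Ω)
    (hb : Bornology.IsBounded Ω) {T : Sp n → E} (hT : ContinuousOn T (closure Ω)) :
    ∃ C, ∀ᵐ x ∂(vol Ω g), ‖T x‖ ≤ C := by
  obtain ⟨C, hC⟩ := hb.isCompact_closure.exists_bound_of_continuousOn hT
  refine ⟨C, ?_⟩
  filter_upwards [ae_mem_vol hΩ] with x hx using hC x (subset_closure hx)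

lemma IsEllipticMetric.isFiniteMeasure (hg : IsEllipticMetric Ω g) (hΩ : IsOpen Ω)
    (hb : Bornology.IsBounded Ω) : IsFiniteMeasure (vol Ω g) := by
  obtain ⟨C, hC⟩ := hb.isCompact_closure.exists_bound_of_continuousOn hg.continuousOn_det.sqrt
  refine ⟨?_⟩
  rw [vol, withDensity_apply _ MeasurableSet.univ, Measure.restrict_univ]
  refine (setLIntegral_mono' hΩ.measurableSet (g := fun _ => ENNReal.ofReal C)
    fun x hx => ?_).trans_lt ?_
  · exact ENNReal.ofReal_le_ofReal ((Real.le_norm_self _).trans (hC x (subset_closure hx)))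
  · rw [setLIntegral_const]
    exact ENNReal.mul_lt_top ENNReal.ofReal_lt_top hb.measure_lt_top

end Measure

section TestFunctions

lemma gradient_eq_toDual_symm (φ : Sp n → ℝ) :
    gradient φ = fun x => (InnerProductSpace.toDual ℝ (Sp n)).symm (fderiv ℝ φ x) := rfl

lemma IsTestFunction.differentiable {φ : Sp n → ℝ} (hφ : IsTestFunction Ω φ) :
    Differentiable ℝ φ := hφ.smooth.differentiable (by simp)

lemma IsTestFunction.memLp {φ : Sp n → ℝ} (hφ : IsTestFunction Ω φ) (μ : Measure (Sp n))
    [IsFiniteMeasure μ] : MemLp φ 2 μ :=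
  hφ.smooth.continuous.memLp_of_hasCompactSupport hφ.compact

lemma IsTestFunction.memLp_gradient {φ : Sp n → ℝ} (hφ : IsTestFunction Ω φ) (μ : Measure (Sp n))
    [IsFiniteMeasure μ] : MemLp (gradient φ) 2 μ := by
  rw [gradient_eq_toDual_symm]
  refine Continuous.memLp_of_hasCompactSupport ?_ ?_
  · exact (LinearIsometryEquiv.continuous _).comp (hφ.smooth.continuous_fderiv (by simp))
  · exact hφ.compact.fderiv (𝕜 := ℝ) |>.comp_left (map_zero _)

lemma IsTestFunction.add {φ ψ : Sp n → ℝ} (hφ : IsTestFunction Ω φ) (hψ : IsTestFunction Ω ψ) :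
    IsTestFunction Ω (φ + ψ) where
  smooth := hφ.smooth.add hψ.smooth
  compact := hφ.compact.add hψ.compact
  support := (tsupport_add φ ψ).trans (union_subset hφ.support hψ.support)

lemma IsTestFunction.smul {φ : Sp n → ℝ} (c : ℝ) (hφ : IsTestFunction Ω φ) :
    IsTestFunction Ω (c • φ) where
  smooth := hφ.smooth.const_smul c
  compact := hφ.compact.smul_left (f := fun _ => c)
  support := (tsupport_smul_subset_right (fun _ => c) φ).trans hφ.support

lemma isTestFunction_zero : IsTestFunction Ω (0 : Sp n → ℝ) where
  smooth := contDiff_const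
  compact := HasCompactSupport.zero
  support := by simp [tsupport]

/-- The pairs `(φ, ∇φ)` for test functions `φ`. -/
def testGraph (Ω : Set (Sp n)) (g : Sp n → Matrix (Fin n) (Fin n) ℝ) :
    Submodule ℝ (L2 Ω g × L2Vec Ω g) where
  carrier := {p | ∃ φ : Sp n → ℝ, IsTestFunction Ω φ ∧
    p.1 =ᵐ[vol Ω g] φ ∧ p.2 =ᵐ[vol Ω g] gradient φ}
  zero_mem' := ⟨0, isTestFunction_zero, Lp.coeFn_zero _ _ _, by
    refine (Lp.coeFn_zero _ _ _).trans (ae_of_all _ fun x => ?_)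
    simp [gradient_eq_toDual_symm]⟩
  add_mem' := by
    rintro a b ⟨φ, hφ, h1, h2⟩ ⟨ψ, hψ, h3, h4⟩
    refine ⟨φ + ψ, hφ.add hψ, (Lp.coeFn_add _ _).trans (h1.add h3),
      (Lp.coeFn_add _ _).trans ((h2.add h4).trans (ae_of_all _ fun x => ?_))⟩
    simp [gradient_eq_toDual_symm, fderiv_add hφ.differentiable.differentiableAt
      hψ.differentiable.differentiableAt]
  smul_mem' := by
    rintro c a ⟨φ, hφ, h1, h2⟩
    refine ⟨c • φ, hφ.smul c, (Lp.coeFn_smul _ _).trans (h1.const_smul c),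
      (Lp.coeFn_smul _ _).trans ((h2.const_smul c).trans (ae_of_all _ fun x => ?_))⟩
    simp [gradient_eq_toDual_symm, fderiv_const_smul hφ.differentiable.differentiableAt]

end TestFunctions

/-- The Dirichlet realization is the operator of a closed quadratic form. -/
theorem exists_form (hΩ : IsOpen Ω) (hb : Bornology.IsBounded Ω) (hg : IsEllipticMetric Ω g)
    (hV : IsPotential Ω V) :
    ∃ (M : L2Vec Ω g →L[ℝ] L2Vec Ω g) (S : L2 Ω g →L[ℝ] L2 Ω g) (c : ℝ), 0 < c ∧
      (∀ G, c * ‖G‖ ^ 2 ≤ inner ℝ (M G) G) ∧ (∀ G G', inner ℝ (M G) G' = inner ℝ G (M G')) ∧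
      (∀ u, 0 ≤ inner ℝ (S u) u) ∧ (∀ u v, inner ℝ (S u) v = inner ℝ u (S v)) ∧
      ∀ (u f : L2 Ω g) (G : L2Vec Ω g),
        (u, G, f) ∈ formGraph (testGraph Ω g).topologicalClosure M S ↔
        (u, G) ∈ H10 Ω g ∧ ∀ φ : Sp n → ℝ, IsTestFunction Ω φ →
        ∫ x, ((∑ i, ∑ j, (g x)⁻¹ i j * G x i * gradient φ x j) + V x * u x * φ x) ∂(vol Ω g)
          = ∫ x, f x * φ x ∂(vol Ω g) := by
  have := hg.isFiniteMeasure hΩ hb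
  obtain ⟨C₁, hC₁⟩ := exists_ae_bound_vol (g := g) hΩ hb hg.continuousOn_coMetric
  obtain ⟨M, hM⟩ := exists_multiplication_operator
    (aestronglyMeasurable_vol (g := g) hΩ hg.continuousOn_coMetric) hC₁
  have hVc : ContinuousOn (fun x => ContinuousLinearMap.mul ℝ ℝ (V x)) (closure Ω) :=
    (ContinuousLinearMap.mul ℝ ℝ).continuous.comp_continuousOn hV.smooth.continuousOn
  obtain ⟨C₂, hC₂⟩ := exists_ae_bound_vol (g := g) hΩ hb hVc
  obtain ⟨S, hS⟩ := exists_multiplication_operator (aestronglyMeasurable_vol (g := g) hΩ hVc) hC₂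
  simp only [ContinuousLinearMap.mul_apply'] at hS
  obtain ⟨c, hc, hcoer⟩ := hg.exists_coMetric_coercive
  refine ⟨M, S, c, hc, fun G => ?_, fun G G' => ?_, fun u => ?_, fun u v => ?_, fun u f G => ?_⟩
  · rw [← real_inner_self_eq_norm_sq, L2.inner_def, L2.inner_def, ← integral_const_mul]
    refine integral_mono_ae ((L2.integrable_inner G G).const_mul c) (L2.integrable_inner _ _) ?_
    filter_upwards [hM G, ae_mem_vol hΩ] with x h1 hx
    simp only [h1, real_inner_self_eq_norm_sq]
    exact hcoer x (subset_closure hx) _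
  · rw [L2.inner_def, L2.inner_def]
    refine integral_congr_ae ?_
    filter_upwards [hM G, hM G', ae_mem_vol hΩ] with x h1 h2 hx
    rw [h1, h2]
    exact hg.coMetric_symm (subset_closure hx) _ _
  · rw [L2.inner_def]
    refine integral_nonneg_of_ae ?_
    filter_upwards [hS u, ae_mem_vol hΩ] with x h1 hx
    have h2 := hV.nonneg x (subset_closure hx)
    simp only [h1, Pi.zero_apply, RCLike.inner_apply, conj_trivial]
    rw [← mul_assoc, mul_comm _ (V x), mul_assoc]
    exact mul_nonneg h2 (mul_self_nonneg _)
  · rw [L2.inner_def, L2.inner_def]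
    refine integral_congr_ae ?_
    filter_upwards [hS u, hS v] with x h1 h2
    simp only [h1, h2, RCLike.inner_apply, conj_trivial]
    ring
  · have key : ∀ φ : Sp n → ℝ, IsTestFunction Ω φ → ∀ q : L2 Ω g × L2Vec Ω g,
        q.1 =ᵐ[vol Ω g] φ → q.2 =ᵐ[vol Ω g] gradient φ →
        (inner ℝ (M G) q.2 + inner ℝ (S u) q.1 = ∫ x, ((∑ i, ∑ j, (g x)⁻¹ i j * G x i *
          gradient φ x j) + V x * u x * φ x) ∂(vol Ω g)) ∧
        inner ℝ f q.1 = ∫ x, f x * φ x ∂(vol Ω g) := by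
      intro φ hφ q h1 h2
      constructor
      · rw [L2.inner_def, L2.inner_def,
          ← integral_add (L2.integrable_inner _ _) (L2.integrable_inner _ _)]
        refine integral_congr_ae ?_
        filter_upwards [hM G, hS u, h1, h2, ae_mem_vol hΩ] with x e1 e2 e3 e4 hx
        rw [e1, e2, e3, e4, hg.coMetric_symm (subset_closure hx), inner_coMetric]
        simp only [RCLike.inner_apply, conj_trivial]
        ring
      · rw [L2.inner_def]
        refine integral_congr_ae ?_
        filter_upwards [h1] with x e1
        simp only [e1, RCLike.inner_apply, conj_trivial]
        ring
    constructor
    · rintro ⟨hD, h⟩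
      refine ⟨hD, fun φ hφ => ?_⟩
      have e1 := (hφ.memLp (vol Ω g)).coeFn_toLp
      have e2 := (hφ.memLp_gradient (vol Ω g)).coeFn_toLp
      obtain ⟨k1, k2⟩ := key φ hφ ((hφ.memLp (vol Ω g)).toLp,
        (hφ.memLp_gradient (vol Ω g)).toLp) e1 e2
      rw [← k1, ← k2]
      exact h _ ((testGraph Ω g).le_topologicalClosure ⟨φ, hφ, e1, e2⟩)
    · rintro ⟨hD, h⟩
      -- For fixed (u, G, f) the weak identity is a closed condition on q, so it extends from test
      -- pairs to their closure H¹₀.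
      refine ⟨hD, fun q hq => ?_⟩
      have hcl : IsClosed {q : L2 Ω g × L2Vec Ω g |
          inner ℝ (M G) q.2 + inner ℝ (S u) q.1 = inner ℝ f q.1} :=
        isClosed_eq (by fun_prop) (by fun_prop)
      refine closure_minimal (s := (testGraph Ω g : Set (L2 Ω g × L2Vec Ω g))) ?_ hcl hq
      rintro q ⟨φ, hφ, e1, e2⟩
      obtain ⟨k1, k2⟩ := key φ hφ q e1 e2
      exact (k1.trans (h φ hφ)).trans k2.symm

variable {Γ : Set (Sp n)}

/-! ### The source as a smooth L²-valued function of time. -/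

section Source

/-- Smooth functions with compact support in `Γ × (0, ∞)`. -/
structure IsSpaceTimeTest (Γ : Set (Sp n)) (F : Sp n × ℝ → ℝ) : Prop where
  smooth : ContDiff ℝ ∞ F
  compact : HasCompactSupport F
  support : tsupport F ⊆ Γ ×ˢ Ioi (0 : ℝ)

/-- The time derivative. -/
def timeDeriv (F : Sp n × ℝ → ℝ) : Sp n × ℝ → ℝ := fun p => fderiv ℝ F p (0, 1)

variable {F : Sp n × ℝ → ℝ}

lemma IsSpaceTimeTest.timeDeriv (hF : IsSpaceTimeTest Γ F) : IsSpaceTimeTest Γ (timeDeriv F) where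
  smooth := (hF.smooth.fderiv_right (by simp)).clm_apply contDiff_const
  compact := hF.compact.fderiv_apply ℝ _
  support := (tsupport_fderiv_apply_subset ℝ _).trans hF.support

lemma IsSpaceTimeTest.iterate (hF : IsSpaceTimeTest Γ F) :
    ∀ k : ℕ, IsSpaceTimeTest Γ (WaveHeat.timeDeriv^[k] F)
  | 0 => hF
  | k + 1 => by
    rw [Function.iterate_succ_apply']
    exact (hF.iterate k).timeDeriv

lemma IsSpaceTimeTest.eq_zero_of_nonpos (hF : IsSpaceTimeTest Γ F) {t : ℝ} (ht : t ≤ 0)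
    (x : Sp n) : F (x, t) = 0 :=
  image_eq_zero_of_notMem_tsupport fun h => absurd (hF.support h).2 (not_lt.2 ht)

lemma IsSpaceTimeTest.eq_zero_of_notMem (hF : IsSpaceTimeTest Γ F) {x : Sp n} (hx : x ∉ Γ)
    (t : ℝ) : F (x, t) = 0 :=
  image_eq_zero_of_notMem_tsupport fun h => hx (hF.support h).1

lemma IsSpaceTimeTest.exists_bound (hF : IsSpaceTimeTest Γ F) :
    ∃ C, 0 ≤ C ∧ ∀ p, ‖F p‖ ≤ C := by
  obtain ⟨C, hC⟩ := hF.smooth.continuous.bounded_above_of_compact_support hF.compact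
  exact ⟨C, (norm_nonneg _).trans (hC (0, 0)), hC⟩

lemma IsSpaceTimeTest.hasDerivAt (hF : IsSpaceTimeTest Γ F) (x : Sp n) (t : ℝ) :
    HasDerivAt (fun s => F (x, s)) (WaveHeat.timeDeriv F (x, t)) t := by
  have h1 : HasFDerivAt F (fderiv ℝ F (x, t)) (x, t) :=
    (hF.smooth.differentiable (by simp)).differentiableAt.hasFDerivAt
  have h2 : HasDerivAt (fun s : ℝ => (x, s)) ((0 : Sp n), (1 : ℝ)) t :=
    (hasDerivAt_const t x).prodMk (hasDerivAt_id t)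
  exact h1.comp_hasDerivAt t h2

variable (μ : Measure (Sp n)) [IsFiniteMeasure μ]

lemma IsSpaceTimeTest.memLp (hF : IsSpaceTimeTest Γ F) (t : ℝ) :
    MemLp (fun x => F (x, t)) 2 μ := by
  obtain ⟨C, -, hC⟩ := hF.exists_bound
  exact MemLp.of_bound (hF.smooth.continuous.comp (by fun_prop)).aestronglyMeasurable C
    (ae_of_all _ fun x => hC _)

/-- The time slices of `F`, as square integrable functions. -/
def IsSpaceTimeTest.slice (hF : IsSpaceTimeTest Γ F) (t : ℝ) : Lp ℝ 2 μ := (hF.memLp μ t).toLp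

lemma IsSpaceTimeTest.coeFn_slice (hF : IsSpaceTimeTest Γ F) (t : ℝ) :
    hF.slice μ t =ᵐ[μ] fun x => F (x, t) := (hF.memLp μ t).coeFn_toLp

/-- The remainder is uniform in x because the second time derivative is bounded. On a finite measure
space this upgrades the pointwise time derivative to one in L². -/
lemma IsSpaceTimeTest.exists_taylor_bound (hF : IsSpaceTimeTest Γ F) :
    ∃ C, 0 ≤ C ∧ ∀ x t s,
      ‖F (x, s) - F (x, t) - (s - t) * WaveHeat.timeDeriv F (x, t)‖ ≤ C * ‖s - t‖ ^ 2 := by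
  obtain ⟨C, hC0, hC⟩ := hF.timeDeriv.timeDeriv.exists_bound
  refine ⟨C, hC0, fun x t s => ?_⟩
  have h1 : ∀ r, ‖WaveHeat.timeDeriv F (x, r) - WaveHeat.timeDeriv F (x, t)‖ ≤ C * ‖r - t‖ :=
    fun r => Convex.norm_image_sub_le_of_norm_hasDerivWithin_le (s := univ)
      (f := fun r => WaveHeat.timeDeriv F (x, r))
      (fun r _ => (hF.timeDeriv.hasDerivAt x r).hasDerivWithinAt) (fun r _ => hC _) convex_univ
      (mem_univ _) (mem_univ _)
  have h2 := Convex.norm_image_sub_le_of_norm_hasDerivWithin_le (s := uIcc t s) (x := t) (y := s)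
    (f := fun r => F (x, r) - r * WaveHeat.timeDeriv F (x, t))
    (f' := fun r => WaveHeat.timeDeriv F (x, r) - WaveHeat.timeDeriv F (x, t)) (C := C * ‖s - t‖)
    (fun r _ => by
      have h3 := (hF.hasDerivAt x r).sub
        ((hasDerivAt_id r).mul_const (WaveHeat.timeDeriv F (x, t)))
      rw [one_mul] at h3
      exact h3.hasDerivWithinAt)
    (fun r hr => (h1 r).trans (mul_le_mul_of_nonneg_left (abs_sub_left_of_mem_uIcc hr) hC0))
    (convex_uIcc t s) left_mem_uIcc right_mem_uIcc
  convert h2 using 1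
  · congr 1
    ring
  · ring

lemma IsSpaceTimeTest.slice_hasDerivAt (hF : IsSpaceTimeTest Γ F) (t : ℝ) :
    HasDerivAt (hF.slice μ) (hF.timeDeriv.slice μ t) t := by
  obtain ⟨C, hC0, hC⟩ := hF.exists_taylor_bound
  rw [hasDerivAt_iff_isLittleO]
  have h1 : (fun s => hF.slice μ s - hF.slice μ t - (s - t) • hF.timeDeriv.slice μ t)
      =O[𝓝 t] fun s => ‖s - t‖ ^ 2 := by
    refine Asymptotics.IsBigO.of_bound
      ((measureUnivNNReal μ : ℝ) ^ (2 : ENNReal).toReal⁻¹ * C) (Eventually.of_forall fun s => ?_)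
    rw [norm_pow, norm_norm, mul_assoc]
    refine Lp.norm_le_of_ae_bound (by positivity) ?_
    filter_upwards [Lp.coeFn_sub (hF.slice μ s - hF.slice μ t)
      ((s - t) • hF.timeDeriv.slice μ t), Lp.coeFn_sub (hF.slice μ s) (hF.slice μ t),
      Lp.coeFn_smul (s - t) (hF.timeDeriv.slice μ t), hF.coeFn_slice μ s, hF.coeFn_slice μ t,
      hF.timeDeriv.coeFn_slice μ t] with x e1 e2 e3 e4 e5 e6
    rw [e1, Pi.sub_apply, e2, Pi.sub_apply, e3, Pi.smul_apply, e4, e5, e6, smul_eq_mul]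
    exact hC x t s
  refine h1.trans_isLittleO ?_
  exact Asymptotics.isLittleO_pow_sub_sub t one_lt_two

lemma IsSpaceTimeTest.isSource (hF : IsSpaceTimeTest Γ F) :
    IsSource fun k => (hF.iterate k).slice μ where
  hasDerivAt k t := by
    refine ((hF.iterate k).slice_hasDerivAt μ t).congr_deriv
      (MemLp.toLp_congr _ _ (ae_of_all _ fun x => ?_))
    rw [Function.iterate_succ_apply']
  of_nonpos k t ht := by
    refine Lp.ext ?_
    filter_upwards [(hF.iterate k).coeFn_slice μ t, Lp.coeFn_zero ℝ 2 μ] with x h1 h2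
    rw [h1, h2, (hF.iterate k).eq_zero_of_nonpos ht]
    rfl

lemma IsSpaceTimeTest.exists_source (hF : IsSpaceTimeTest Γ F) :
    ∃ f : ℕ → ℝ → Lp ℝ 2 μ, IsSource f ∧ ∀ t, f 0 t =ᵐ[μ] fun x => F (x, t) :=
  ⟨_, hF.isSource μ, hF.coeFn_slice μ⟩

end Source

/-! ### Comparison of measures on Γ and the link to the abstract theory. -/

section Restriction

/-- The Riemannian measure dominates the Lebesgue measure. -/
lemma IsEllipticMetric.exists_volume_le (hg : IsEllipticMetric Ω g) (hΩ : IsOpen Ω)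
    (hb : Bornology.IsBounded Ω) :
    ∃ C : ENNReal, C ≠ ⊤ ∧ (volume.restrict Ω : Measure (Sp n)) ≤ C • vol Ω g := by
  have hc : ContinuousOn (fun x => (√(g x).det)⁻¹) (closure Ω) :=
    hg.continuousOn_det.sqrt.inv₀ fun x hx => (Real.sqrt_pos.2 (hg.det_pos hx)).ne'
  obtain ⟨C, hC⟩ := hb.isCompact_closure.exists_bound_of_continuousOn hc
  refine ⟨ENNReal.ofReal C, ENNReal.ofReal_ne_top, ?_⟩
  rw [vol, ← withDensity_smul' _ _ ENNReal.ofReal_ne_top]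
  conv_lhs => rw [← withDensity_one (μ := volume.restrict Ω)]
  refine withDensity_mono ?_
  filter_upwards [ae_restrict_mem hΩ.measurableSet] with x hx
  have h1 := Real.sqrt_pos.2 (hg.det_pos (subset_closure hx))
  have h2 := (Real.le_norm_self _).trans (hC x (subset_closure hx))
  rw [Pi.one_apply, Pi.smul_apply, smul_eq_mul,
    ← ENNReal.ofReal_mul ((inv_pos.2 h1).le.trans h2), ENNReal.one_le_ofReal]
  rwa [inv_le_iff_one_le_mul₀ h1] at h2

lemma IsEllipticMetric.memLp_restrict (hg : IsEllipticMetric Ω g) (hΩ : IsOpen Ω)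
    (hb : Bornology.IsBounded Ω) (hΓ : Γ ⊆ Ω) (w : L2 Ω g) : MemLp w 2 (volume.restrict Γ) := by
  obtain ⟨C, hC, hle⟩ := hg.exists_volume_le hΩ hb
  exact MemLp.of_measure_le_smul hC ((Measure.restrict_mono_set _ hΓ).trans hle) (Lp.memLp w)

lemma IsEllipticMetric.restrict_absolutelyContinuous (hg : IsEllipticMetric Ω g) (hΩ : IsOpen Ω)
    (hb : Bornology.IsBounded Ω) (hΓ : Γ ⊆ Ω) :
    (volume.restrict Γ : Measure (Sp n)) ≪ (vol Ω g).restrict Γ := by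
  obtain ⟨C, hC, hle⟩ := hg.exists_volume_le hΩ hb
  have h1 := (Measure.absolutelyContinuous_of_le_smul hle).restrict Γ
  rwa [Measure.restrict_restrict_of_subset hΓ] at h1

lemma vol_restrict_absolutelyContinuous (hΓ : Γ ⊆ Ω) :
    (vol Ω g).restrict Γ ≪ volume.restrict Γ := by
  have h1 := (vol_absolutelyContinuous (Ω := Ω) (g := g)).restrict Γ
  rwa [Measure.restrict_restrict_of_subset hΓ] at h1

lemma vol_restrict_congr {g₁ g₂ : Sp n → Matrix (Fin n) (Fin n) ℝ} (hΓo : IsOpen Γ) (hΓ : Γ ⊆ Ω)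
    (hg : ∀ x ∈ Γ, g₁ x = g₂ x) : (vol Ω g₁).restrict Γ = (vol Ω g₂).restrict Γ := by
  rw [vol, vol, restrict_withDensity hΓo.measurableSet, restrict_withDensity hΓo.measurableSet,
    Measure.restrict_restrict_of_subset hΓ]
  refine withDensity_congr_ae ?_
  filter_upwards [ae_restrict_mem hΓo.measurableSet] with x hx
  rw [hg x hx]

end Restriction

section Heat

lemma IsHeatKernel.exists_orbit {K : ℝ → Sp n → Sp n → ℝ} (hK : IsHeatKernel Ω g V K)
    {P : Submodule ℝ (L2 Ω g × L2 Ω g)} (hP : ∀ u f, (u, f) ∈ P ↔ IsP Ω g V u f) (f : L2 Ω g) :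
    ∃ u p, IsOrbit P u p ∧ u 0 = f ∧
      ∀ t > 0, u t =ᵐ[vol Ω g] fun x => ∫ z, K t x z * f z ∂(vol Ω g) := by
  obtain ⟨u, ⟨hc, h0, Pu, hPu, h⟩, hK⟩ := hK.represents f
  exact ⟨u, Pu, ⟨hc, hPu, fun t ht => (hP _ _).2 (h t ht).1, fun t ht => (h t ht).2⟩, h0, hK⟩

end Heat

/-- The last clause supplies the time-continuous gradient demanded of ∂ₜw in the definition of a
wave solution. -/
theorem exists_dirichlet_realization (hΩ : IsOpen Ω) (hb : Bornology.IsBounded Ω)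
    (hg : IsEllipticMetric Ω g) (hV : IsPotential Ω V) {K : ℝ → Sp n → Sp n → ℝ}
    (hK : IsHeatKernel Ω g V K) :
    ∃ P : Submodule ℝ (L2 Ω g × L2 Ω g), IsNonnegSelfAdjoint P ∧
      (∀ u f, (u, f) ∈ P ↔ IsP Ω g V u f) ∧
      ∀ w f : ℝ → L2 Ω g, Continuous w → Continuous f → (∀ t, (w t, f t) ∈ P) →
        ∃ G : ℝ → L2Vec Ω g, Continuous G ∧ ∀ t, (w t, G t) ∈ H10 Ω g := by
  obtain ⟨M, S, c, hc, hM, hMs, hS, hSs, hform⟩ := exists_form hΩ hb hg hV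
  have hP : ∀ u f, (u, f) ∈ formOperator (testGraph Ω g).topologicalClosure M S ↔
      IsP Ω g V u f := fun u f =>
    mem_formOperator.trans (exists_congr fun G => hform u f G)
  have hn := formOperator_nonneg (D := (testGraph Ω g).topologicalClosure) hc hM hS
  refine ⟨formOperator (testGraph Ω g).topologicalClosure M S, ?_, hP, ?_⟩
  · refine isNonnegSelfAdjoint_of_orbits
      (isClosed_formOperator hc (testGraph Ω g).isClosed_topologicalClosure hM hS)
      (formOperator_symm hMs hSs) hn fun f => ?_
    obtain ⟨u, p, hu, h0, -⟩ := hK.exists_orbit hP f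
    exact ⟨u, p, hu, h0⟩
  · intro w f hw hf h
    choose G hG using fun t => mem_formOperator.1 (h t)
    exact ⟨G, continuous_gradient_of_mem_formGraph hc hM hS hw hf hG, fun t => (hG t).1⟩

section Wave

variable {P : Submodule ℝ (L2 Ω g × L2 Ω g)} {F : Sp n × ℝ → ℝ} {f X : ℕ → ℝ → L2 Ω g}

lemma isWaveSolution_of_derivs (hP : ∀ u f, (u, f) ∈ P ↔ IsP Ω g V u f)
    (hG : ∀ w f : ℝ → L2 Ω g, Continuous w → Continuous f → (∀ t, (w t, f t) ∈ P) →
        ∃ G : ℝ → L2Vec Ω g, Continuous G ∧ ∀ t, (w t, G t) ∈ H10 Ω g)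
    (hf : IsSource f) (hfF : ∀ t, f 0 t =ᵐ[vol Ω g] fun x => F (x, t))
    (hd : ∀ k t, HasDerivAt (X k) (X (k + 1) t) t) (h0 : ∀ k, X k 0 = 0)
    (hX : ∀ k t, (X k t, f k t - X (k + 2) t) ∈ P) : IsWaveSolution Ω g V F (X 0) := by
  have hc : ∀ k, Continuous (X k) := fun k =>
    continuous_iff_continuousAt.2 fun t => (hd k t).continuousAt
  -- The velocity itself lies in Dom(P), with Pw' = f' - w''', so its gradient is continuous in
  -- time.
  obtain ⟨G, hGc, hGm⟩ := hG (X 1) (fun t => f 1 t - X 3 t) (hc 1)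
    ((hf.continuous 1).sub (hc 3)) (hX 1)
  refine ⟨X 1, X 2, fun t => f 0 t - X 2 t, G, (hc 0).continuousOn,
    ((hf.continuous 0).sub (hc 2)).continuousOn, (hc 1).continuousOn, hGc.continuousOn,
    (hc 2).continuousOn, h0 0, h0 1, fun t _ => ⟨(hd 0 t).hasDerivWithinAt,
      (hd 1 t).hasDerivWithinAt, (hP _ _).1 (hX 0 t), hGm t, ?_⟩⟩
  simpa using hfF t

lemma IsWaveSolution.eq_of_derivs (hSA : IsNonnegSelfAdjoint P)
    (hP : ∀ u f, (u, f) ∈ P ↔ IsP Ω g V u f) (hfF : ∀ t, f 0 t =ᵐ[vol Ω g] fun x => F (x, t))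
    (hd : ∀ k t, HasDerivAt (X k) (X (k + 1) t) t) (h0 : ∀ k, X k 0 = 0)
    (hX : ∀ k t, (X k t, f k t - X (k + 2) t) ∈ P) {w : ℝ → L2 Ω g}
    (hw : IsWaveSolution Ω g V F w) : ∀ t ≥ 0, w t = X 0 t := by
  obtain ⟨w', w'', Pw, G', -, -, -, -, hw''c, hw0, hw'0, h⟩ := hw
  intro t ht
  refine sub_eq_zero.1 (wave_unique hSA (w := fun t => w t - X 0 t) (w' := fun t => w' t - X 1 t)
    (w'' := fun t => w'' t - X 2 t) ?_ (by simp [hw0, h0]) (by simp [hw'0, h0])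
    (fun s hs => (h s hs).1.sub (hd 0 s).hasDerivWithinAt)
    (fun s hs => (h s hs).2.1.sub (hd 1 s).hasDerivWithinAt) (fun s hs => ?_) t ht)
  · exact hw''c.sub (fun s _ => (hd 2 s).continuousAt.continuousWithinAt)
  · obtain ⟨-, -, hIsP, -, hae⟩ := h s hs
    have h1 : w'' s + Pw s = f 0 s := Lp.ext (hae.trans (hfF s).symm)
    have h2 := P.sub_mem ((hP _ _).2 hIsP) (hX 0 s)
    rw [← h1] at h2
    convert h2 using 1
    refine Prod.ext rfl ?_
    simp only [Prod.snd_sub]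
    abel

end Wave

section Pairing

variable {g₁ g₂ : Sp n → Matrix (Fin n) (Fin n) ℝ}

lemma restrict_inter_vol {A : Set (Sp n)} (hA : MeasurableSet A) (u : Sp n → ℝ) :
    ∫ x in A ∩ Γ, u x ∂(vol Ω g) = ∫ x in A, u x ∂((vol Ω g).restrict Γ) := by
  rw [Measure.restrict_restrict hA]

/-- Since φ vanishes off Γ, both variables range over Γ, where the two volumes coincide and the
kernels agree almost everywhere. -/
lemma kernel_pairing_eq (hΓo : IsOpen Γ) (hΓ : Γ ⊆ Ω) (hg : ∀ x ∈ Γ, g₁ x = g₂ x)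
    {K₁ K₂ : Sp n → Sp n → ℝ} (hK : ∀ᵐ p ∂((volume.restrict Γ).prod (volume.restrict Γ)),
      K₁ p.1 p.2 = K₂ p.1 p.2) {φ : Sp n → ℝ} (hφ : ∀ x ∉ Γ, φ x = 0) {A : Set (Sp n)}
    (hA : MeasurableSet A) :
    ∫ x in A ∩ Γ, ∫ z, K₁ x z * φ z ∂(vol Ω g₁) ∂(vol Ω g₁)
      = ∫ x in A ∩ Γ, ∫ z, K₂ x z * φ z ∂(vol Ω g₂) ∂(vol Ω g₂) := by
  have hν := vol_restrict_congr (Ω := Ω) hΓo hΓ hg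
  have hac := vol_restrict_absolutelyContinuous (g := g₁) hΓ
  have hin : ∀ (g : Sp n → Matrix (Fin n) (Fin n) ℝ) (k : Sp n → ℝ),
      ∫ z, k z * φ z ∂(vol Ω g) = ∫ z in Γ, k z * φ z ∂(vol Ω g) := fun g k =>
    (setIntegral_eq_integral_of_forall_compl_eq_zero fun x hx => by rw [hφ x hx, mul_zero]).symm
  simp only [hin]
  rw [restrict_inter_vol hA, restrict_inter_vol hA, ← hν]
  refine integral_congr_ae (ae_restrict_of_ae ?_)
  filter_upwards [hac.ae_le (Measure.ae_ae_of_ae_prod hK)] with x hx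
  refine integral_congr_ae ?_
  filter_upwards [hac.ae_le hx] with z hz
  rw [hz]

lemma ae_eq_of_setIntegral_eq (hΩ : IsOpen Ω) (hb : Bornology.IsBounded Ω) (hΓo : IsOpen Γ)
    (hΓ : Γ ⊆ Ω) (hg₁ : IsEllipticMetric Ω g₁) (hg₂ : IsEllipticMetric Ω g₂)
    (hg : ∀ x ∈ Γ, g₁ x = g₂ x) {w₁ : L2 Ω g₁} {w₂ : L2 Ω g₂}
    (h : ∀ A, MeasurableSet A →
      ∫ x in A ∩ Γ, w₁ x ∂(vol Ω g₁) = ∫ x in A ∩ Γ, w₂ x ∂(vol Ω g₂)) :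
    w₁ =ᵐ[volume.restrict Γ] w₂ := by
  have := hg₁.isFiniteMeasure hΩ hb
  have := hg₂.isFiniteMeasure hΩ hb
  have hν := vol_restrict_congr (Ω := Ω) hΓo hΓ hg
  refine (hg₁.restrict_absolutelyContinuous hΩ hb hΓ).ae_le ?_
  refine Integrable.ae_eq_of_forall_setIntegral_eq _ _
    (((Lp.memLp w₁).integrable one_le_two).mono_measure Measure.restrict_le_self) ?_ ?_
  · rw [hν]
    exact ((Lp.memLp w₂).integrable one_le_two).mono_measure Measure.restrict_le_self
  · intro A hA _
    have h1 := h A hA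
    rwa [restrict_inter_vol hA, restrict_inter_vol hA, ← hν] at h1

end Pairing

lemma sourceToSolution_eq_singleton {F : Sp n × ℝ → ℝ} {X : ℝ → L2 Ω g}
    (hX : IsWaveSolution Ω g V F X) (hu : ∀ w, IsWaveSolution Ω g V F w → ∀ t ≥ 0, w t = X t)
    {r : ℝ≥0 → Lp ℝ 2 (volume.restrict Γ)} (hr : ∀ t : ℝ≥0, r t =ᵐ[volume.restrict Γ] X t) :
    sourceToSolution Ω Γ g V F = {r} := by
  refine eq_singleton_iff_unique_mem.2 ⟨⟨X, hX, hr⟩, ?_⟩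
  rintro r' ⟨w, hw, hr'⟩
  funext t
  refine Lp.ext ((hr' t).trans ?_)
  rw [hu w hw t t.2]
  exact (hr t).symm

end WaveHeat

end

/-! ### The theorem on source-to-solution maps. -/

theorem mainTheorem7 (n : ℕ) (hn : 2 ≤ n)
    (Ω Γ : Set (WaveHeat.Sp n))
    (hΩ : WaveHeat.IsSmoothDomain Ω) (hΩb : Bornology.IsBounded Ω)
    (hΓ : WaveHeat.IsSmoothDomain Γ) (hΓΩ : closure Γ ⊆ Ω)
    (hcompl : IsConnected (Ω \ closure Γ))
    (g₁ g₂ : WaveHeat.Sp n → Matrix (Fin n) (Fin n) ℝ) (V₁ V₂ : WaveHeat.Sp n → ℝ)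
    (hg₁ : WaveHeat.IsEllipticMetric Ω g₁) (hg₂ : WaveHeat.IsEllipticMetric Ω g₂)
    (hV₁ : WaveHeat.IsPotential Ω V₁) (hV₂ : WaveHeat.IsPotential Ω V₂)
    (hg : ∀ x ∈ Γ, g₁ x = g₂ x) (hV : ∀ x ∈ Γ, V₁ x = V₂ x)
    (K₁ K₂ : ℝ → WaveHeat.Sp n → WaveHeat.Sp n → ℝ)
    (hK₁ : WaveHeat.IsHeatKernel Ω g₁ V₁ K₁) (hK₂ : WaveHeat.IsHeatKernel Ω g₂ V₂ K₂)
    (hK : ∀ t > 0, ∀ᵐ p ∂((volume.restrict Γ).prod (volume.restrict Γ)),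
      K₁ t p.1 p.2 = K₂ t p.1 p.2)
    (F : WaveHeat.Sp n × ℝ → ℝ) (hF : ContDiff ℝ ∞ F) (hFc : HasCompactSupport F)
    (hFs : tsupport F ⊆ Γ ×ˢ Ioi (0 : ℝ)) :
    ∃ r : ℝ≥0 → Lp ℝ 2 (volume.restrict Γ),
      WaveHeat.sourceToSolution Ω Γ g₁ V₁ F = {r} ∧
      WaveHeat.sourceToSolution Ω Γ g₂ V₂ F = {r} := by
  have hsub : Γ ⊆ Ω := subset_closure.trans hΓΩ
  have hΩo := hΩ.isOpen
  have hΓo := hΓ.isOpen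
  have := hg₁.isFiniteMeasure hΩo hΩb
  have := hg₂.isFiniteMeasure hΩo hΩb
  have hT : WaveHeat.IsSpaceTimeTest Γ F := ⟨hF, hFc, hFs⟩
  obtain ⟨P₁, hSA₁, hP₁, hG₁⟩ := WaveHeat.exists_dirichlet_realization hΩo hΩb hg₁ hV₁ hK₁
  obtain ⟨P₂, hSA₂, hP₂, hG₂⟩ := WaveHeat.exists_dirichlet_realization hΩo hΩb hg₂ hV₂ hK₂
  obtain ⟨f₁, hf₁, hs₁⟩ := hT.exists_source (WaveHeat.vol Ω g₁)
  obtain ⟨f₂, hf₂, hs₂⟩ := hT.exists_source (WaveHeat.vol Ω g₂)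
  obtain ⟨X₁, X₂, ⟨hd₁, h0₁, hX₁⟩, ⟨hd₂, h0₂, hX₂⟩, hpair⟩ :=
    WaveHeat.exists_wave_pairing_eq hSA₁ hSA₂ hf₁ hf₂
  have hagree : ∀ t, X₁ 0 t =ᵐ[volume.restrict Γ] X₂ 0 t := by
    intro t
    refine WaveHeat.ae_eq_of_setIntegral_eq hΩo hΩb hΓo hsub hg₁ hg₂ hg fun A hA => ?_
    have hAΓ := hA.inter hΓo.measurableSet
    -- Integrals over A ∩ Γ are pairings with its indicator, taken in each of the two L² spaces.
    -- This puts the claim in the form handled by the abstract comparison.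
    rw [← L2.inner_indicatorConstLp_one (𝕜 := ℝ) hAΓ (measure_ne_top _ _),
      ← L2.inner_indicatorConstLp_one (𝕜 := ℝ) hAΓ (measure_ne_top _ _)]
    refine hpair _ _ (fun s => ?_) t
    obtain ⟨u₁, p₁, hu₁, e₁, k₁⟩ := hK₁.exists_orbit hP₁ (f₁ 0 s)
    obtain ⟨u₂, p₂, hu₂, e₂, k₂⟩ := hK₂.exists_orbit hP₂ (f₂ 0 s)
    refine ⟨u₁, p₁, u₂, p₂, hu₁, e₁, hu₂, e₂, fun τ hτ => ?_⟩
    rw [L2.inner_indicatorConstLp_one hAΓ (measure_ne_top _ _),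
      L2.inner_indicatorConstLp_one hAΓ (measure_ne_top _ _)]
    -- At τ = 0 there is no kernel: both orbits start from the same slice of F, and the volumes
    -- agree on Γ.
    rcases eq_or_lt_of_le hτ with rfl | hτ
    · rw [e₁, e₂, integral_congr_ae (ae_restrict_of_ae (hs₁ s)),
        integral_congr_ae (ae_restrict_of_ae (hs₂ s)), WaveHeat.restrict_inter_vol hA,
        WaveHeat.restrict_inter_vol hA, WaveHeat.vol_restrict_congr hΓo hsub hg]
    · have hin : ∀ {g : WaveHeat.Sp n → Matrix (Fin n) (Fin n) ℝ} {f : WaveHeat.L2 Ω g}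
          (k : WaveHeat.Sp n → ℝ), f =ᵐ[WaveHeat.vol Ω g] (fun x => F (x, s)) →
          ∫ z, k z * f z ∂(WaveHeat.vol Ω g) = ∫ z, k z * F (z, s) ∂(WaveHeat.vol Ω g) := by
        intro g f k hf
        refine integral_congr_ae ?_
        filter_upwards [hf] with z hz
        rw [hz]
      rw [integral_congr_ae (ae_restrict_of_ae (k₁ τ hτ)),
        integral_congr_ae (ae_restrict_of_ae (k₂ τ hτ))]
      simp only [hin _ (hs₁ s), hin _ (hs₂ s)]
      exact WaveHeat.kernel_pairing_eq hΓo hsub hg (hK τ hτ)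
        (fun x hx => hT.eq_zero_of_notMem hx s) hA
  have hmem := fun t : ℝ => hg₁.memLp_restrict hΩo hΩb hsub (X₁ 0 t)
  -- The common restriction is taken from the first wave; `hagree` identifies it with that of the
  -- second.
  refine ⟨fun t => (hmem t).toLp, ?_, ?_⟩
  · exact WaveHeat.sourceToSolution_eq_singleton
      (WaveHeat.isWaveSolution_of_derivs hP₁ hG₁ hf₁ hs₁ hd₁ h0₁ hX₁)
      (fun w hw => hw.eq_of_derivs hSA₁ hP₁ hs₁ hd₁ h0₁ hX₁) fun t => (hmem t).coeFn_toLp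
  · exact WaveHeat.sourceToSolution_eq_singleton
      (WaveHeat.isWaveSolution_of_derivs hP₂ hG₂ hf₂ hs₂ hd₂ h0₂ hX₂)
      (fun w hw => hw.eq_of_derivs hSA₂ hP₂ hs₂ hd₂ h0₂ hX₂)
      fun t => (hmem t).coeFn_toLp.trans (hagree t)
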